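/- Let $\mathbb k$ be an algebraically closed field of characteristic zero and let $\mathfrak g$ be a finite-dimensional semisimple Lie algebra over $\mathbb k$ with adjoint group $G$. For $M\subset\mathfrak g$ let $\mathfrak z_{\mathfrak g}(M)$ be the centralizer of $M$ in $\mathfrak g$. Let $(e_1,e_2)\in\mathfrak g\times\mathfrak g$ with $[e_1,e_2]=0$. A pair $(h_1,h_2)$ of semisimple elements of $\mathfrak g$ is called *an associated semisimple pair* of $(e_1,e_2)$ if $[h_1,h_2]=0$ and $[h_i,e_j]=\delta_{ij}e_j$ for $i,j\in\{1,2\}$. The pair $(e_1,e_2)$ is *principal nilpotent* if $\dim\mathfrak z_{\mathfrak g}(e_1,e_2)=\operatorname{rk}\mathfrak g$ and for all $t_1,t_2\in\mathbb k^*$ there is $g\in G$ with $(g\cdot e_1,g\cdot e_2)=(t_1e_1,t_2e_2)$. It is *almost principal nilpotent* if $\dim\mathfrak z_{\mathfrak g}(e_1,e_2)=\operatorname{rk}\mathfrak g+1$ and it has an associated semisimple pair. A nilpotent element $e$ of $\mathfrak g$ contained in a reductive subalgebra $\mathfrak l$ is called *regular nilpotent in $\mathfrak l$* if $\dim\mathfrak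 z_{\mathfrak l}(e)=\operatorname{rk}\mathfrak l$. For $e\in\mathfrak g$ and a subspace $M\subset\mathfrak g$ put $\lim_e M=\sum_{i\ge 0}(\operatorname{ad} e)^i\{x\in M\mid(\operatorname{ad} e)^{i+1}x=0\}$. **Theorem.** Let $(e_1,e_2)$ be a principal or almost principal nilpotent pair in $\mathfrak g$, and let $(h_1,h_2)$ be an associated semisimple pair. Put $\mathfrak t=\mathfrak z_{\mathfrak g}(h_1,h_2)$ and $\mathfrak l_i=\mathfrak z_{\mathfrak g}(h_i)$, and let $\mathfrak c_i$ be the centre of $\mathfrak l_i$ ($i=1,2$). Then: 1. $e_1$ is regular nilpotent in $\mathfrak l_2$, and $e_2$ is regular nilpotent in $\mathfrak l_1$; 2. $\lim_{e_1}\mathfrak t=\mathfrak z_{\mathfrak g}(e_1,h_2)$ and $\lim_{e_2}\mathfrak t=\mathfrak z_{\mathfrak g}(e_2,h_1)$; 3. $\dim\mathfrak z_{\mathfrak g}(e_1,h_1,e_2)=\dim\mathfrak z_{\mathfrak g}(e_1,h_1,h_2)$ and $\dim\mathfrak z_{\mathfrak g}(e_2,h_2,e_1)=\dim\mathfrak z_{\mathfrak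 g}(e_2,h_2,h_1)$; 4. $\mathfrak z_{\mathfrak g}(e_1,h_1,h_2)=\mathfrak c_2$ and $\mathfrak z_{\mathfrak g}(e_2,h_1,h_2)=\mathfrak c_1$. -/

import Mathlib

namespace NilpotentPair

variable (K : Type*) {L : Type*} [Field K] [LieRing L] [LieAlgebra K L]

/-- The centralizer `z(S)` of a set `S` in the Lie algebra `L`, as a Lie subalgebra. -/
def centralizer (S : Set L) : LieSubalgebra K L where
  carrier := {x | ∀ s ∈ S, ⁅x, s⁆ = 0}
  zero_mem' := by
    intro s _
    exact zero_lie s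
  add_mem' := by
    intro x y hx hy s hs
    rw [add_lie, hx s hs, hy s hs, add_zero]
  smul_mem' := by
    intro c x hx s hs
    rw [smul_lie, hx s hs, smul_zero]
  lie_mem' := by
    intro x y hx hy s hs
    rw [lie_lie, hx s hs, hy s hs, lie_zero, lie_zero, sub_zero]

theorem mem_centralizer {S : Set L} {x : L} :
    x ∈ centralizer K S ↔ ∀ s ∈ S, ⁅x, s⁆ = 0 := Iff.rfl

variable (L) in
/-- The adjoint group of `L`: the subgroup of `GL(L)` generated by the exponentials
`exp (ad x)` of the ad-nilpotent elements `x` (a finite sum, since `(ad x) ^ n = 0`).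
For a semisimple Lie algebra over an algebraically closed field of characteristic zero this is
the identity component of the automorphism group. -/
def adjointGroup : Subgroup (L ≃ₗ[K] L) :=
  Subgroup.closure {φ | ∃ (x : L) (n : ℕ), (LieAlgebra.ad K L x) ^ n = 0 ∧
    (φ : Module.End K L) =
      ∑ i ∈ Finset.range n, ((Nat.factorial i : K)⁻¹) • (LieAlgebra.ad K L x) ^ i}

/-- `x` is a semisimple element: `ad x` is a semisimple endomorphism. -/
def IsSemisimpleElement (x : L) : Prop := (LieAlgebra.ad K L x).IsSemisimple

/-- `(h₁, h₂)` is a semisimple pair associated with `(e₁, e₂)`: two commuting semisimple elements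
with `[h_i, e_j] = δ_{ij} e_j`. -/
structure IsAssociatedSemisimplePair (e₁ e₂ h₁ h₂ : L) : Prop where
  semisimple₁ : IsSemisimpleElement K h₁
  semisimple₂ : IsSemisimpleElement K h₂
  comm : ⁅h₁, h₂⁆ = 0
  lie₁₁ : ⁅h₁, e₁⁆ = e₁
  lie₁₂ : ⁅h₁, e₂⁆ = 0
  lie₂₁ : ⁅h₂, e₁⁆ = 0
  lie₂₂ : ⁅h₂, e₂⁆ = e₂

/-- Principal nilpotent pairs: commuting pairs whose simultaneous centralizer has dimension equal
to the rank, and which can be rescaled independently by the adjoint group. -/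
structure IsPrincipalNilpotentPair [Module.Finite K L] (e₁ e₂ : L) : Prop where
  comm : ⁅e₁, e₂⁆ = 0
  finrank_centralizer : Module.finrank K (centralizer K {e₁, e₂}) = LieAlgebra.rank K L
  scaling : ∀ t₁ t₂ : K, t₁ ≠ 0 → t₂ ≠ 0 →
    ∃ g ∈ adjointGroup K L, g e₁ = t₁ • e₁ ∧ g e₂ = t₂ • e₂

/-- Almost principal nilpotent pairs: commuting pairs whose simultaneous centralizer has dimension
equal to the rank plus one, and which have an associated semisimple pair. -/
structure IsAlmostPrincipalNilpotentPair [Module.Finite K L] (e₁ e₂ : L) : Prop where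
  comm : ⁅e₁, e₂⁆ = 0
  finrank_centralizer : Module.finrank K (centralizer K {e₁, e₂}) = LieAlgebra.rank K L + 1
  exists_associated : ∃ h₁ h₂ : L, IsAssociatedSemisimplePair K e₁ e₂ h₁ h₂

/-- `e` is a regular nilpotent element of the subalgebra `l`: it lies in `l`, it is nilpotent
(as an element of the ambient semisimple Lie algebra), and its centralizer in `l` has
dimension equal to the rank of `l`. -/
structure IsRegularNilpotentIn [Module.Finite K L] (l : LieSubalgebra K L) (e : L) : Prop where
  mem : e ∈ l
  nilpotent : IsNilpotent (LieAlgebra.ad K L e)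
  finrank_centralizer :
    Module.finrank K (l ⊓ centralizer K {e} : LieSubalgebra K L) = LieAlgebra.rank K l

/-- The filtration `M(i) = {x ∈ M | (ad e)^{i+1} x = 0}` of a subspace `M`. -/
def filtration (e : L) (M : Submodule K L) (i : ℕ) : Submodule K L :=
  M ⊓ LinearMap.ker ((LieAlgebra.ad K L e) ^ (i + 1))

/-- The limit `lim_e M = ∑_{i ≥ 0} (ad e)^i M(i)`. -/
def lim (e : L) (M : Submodule K L) : Submodule K L :=
  ⨆ i : ℕ, (filtration K e M i).map ((LieAlgebra.ad K L e) ^ i)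

/-- The centre of a Lie subalgebra `l`, as a subspace of the ambient Lie algebra. -/
def centre (l : LieSubalgebra K L) : Submodule K L :=
  (LieAlgebra.center K l).toSubmodule.map l.toSubmodule.subtype

end NilpotentPair

/-! Both kinds of pairs satisfy `dim 𝔷(e₁,e₂) ≤ rk + 1`, and the argument treats them together
(`IsNearPrincipal`). Taking `lim` along a degree-raising operator does not lower dimension, since
the pieces `(ad e)^i M(i)` lie in distinct eigenspaces (`finrank_le_finrank_limSubmodule`). Passing
from `𝔱` by `lim_{e₁}` into `𝔷(e₁,h₂)` and by `lim_{e₂}` into `𝔷(e₁,e₂)` gives `rk ≤ dim 𝔱 ≤ dim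
𝔷(e₁,h₂) ≤ rk + 1`. Centralizers of elements have even codimension in `𝔤` and in `𝔩₂`, because the
form `κ([x,y],z)` is alternating; hence both dimensions equal `rk`
(`finrank_torus_and_centralizer`). This yields the limit formula, regularity of `e₁`, and that `𝔱`
is a Cartan subalgebra.

For the centre, highest weight vectors of `e₁` in `𝔩₂` have degrees in `ℕ`, so by Killing duality
`e₁` is surjective in `𝔩₂` from degree `n` to `n + 1`. An element commuting with `e₁` and `𝔱` then
kills all nonnegative degrees, and by duality the negative ones.

In the equality of triple centralizers, `lim_{e₂}` gives one inequality. If it were strict, the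
surplus dimension of `𝔷(e₁,e₂)` would lie in `h₁`-degree zero, so integrality and surjectivity of
`e₁` would extend from `𝔩₂` to all of `𝔤`. A base adapted to the lexicographic order of degrees then
has simple roots of degree `(0,1)` or `(1,*)`, and `e₂` can be completed by some `v` of `h₁`-degree
1 to a principal nilpotent `e₂ + v` (`exists_complement_of_lt`). The map `a ↦ [a,v]` from `𝔷(e₂,h₁)`
onto `𝔤₁/[e₂,𝔤₁]`, with `𝔤₁` the `h₁`-degree 1 space, has `𝔷(e₁,h₁,e₂)` in its kernel, and counting
dimensions gives the reverse inequality (`finrank_triple_le_of_exists`), a contradiction. -/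

namespace NilpotentPair

open Module

/-! ### Linear algebra preliminaries. -/

theorem finrank_map_add_finrank_inf_ker {K V W : Type*} [Field K] [AddCommGroup V] [Module K V]
    [FiniteDimensional K V] [AddCommGroup W] [Module K W] (f : V →ₗ[K] W) (U : Submodule K V) :
    finrank K (U.map f) + finrank K (U ⊓ LinearMap.ker f : Submodule K V) = finrank K U := by
  have h1 := (f.domRestrict U).finrank_range_add_finrank_ker
  rw [LinearMap.range_domRestrict] at h1
  rw [← h1]
  congr 1
  have h2 : (LinearMap.ker (f.domRestrict U)).map U.subtype = U ⊓ LinearMap.ker f := by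
    ext x
    simp only [Submodule.mem_map, LinearMap.mem_ker, LinearMap.domRestrict_apply,
      Submodule.coe_subtype, Subtype.exists, exists_and_left, exists_prop, Submodule.mem_inf]
    constructor
    · rintro ⟨y, hy, hyW, rfl⟩
      exact ⟨hyW, hy⟩
    · rintro ⟨hx, hx'⟩
      exact ⟨x, hx', hx, rfl⟩
  rw [← h2, Submodule.finrank_map_subtype_eq]

theorem disjoint_ker_range_of_isSemisimple {K V : Type*} [Field K] [AddCommGroup V] [Module K V]
    {D : End K V} (hD : D.IsSemisimple) : Disjoint (LinearMap.ker D) (LinearMap.range D) := by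
  rw [Submodule.disjoint_def]
  rintro _ hx ⟨y, rfl⟩
  have hy : y ∈ D.maxGenEigenspace 0 := by
    rw [End.mem_maxGenEigenspace]
    refine ⟨2, ?_⟩
    rw [zero_smul, sub_zero, pow_two, End.mul_apply]
    exact hx
  rw [hD.isFinitelySemisimple.maxGenEigenspace_eq_eigenspace, End.mem_eigenspace_iff,
    zero_smul] at hy
  exact hy

theorem exists_pow_apply_ne_zero {K V : Type*} [Field K] [AddCommGroup V] [Module K V]
    {A : End K V} (hA : IsNilpotent A) {x : V} (hx : x ≠ 0) :
    ∃ k, (A ^ k) x ≠ 0 ∧ A ((A ^ k) x) = 0 := by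
  classical
  have h : ∃ n, (A ^ n) x = 0 := by
    obtain ⟨n, hn⟩ := hA
    exact ⟨n, by simp [hn]⟩
  have h0 : Nat.find h ≠ 0 := fun h0 => hx (by simpa [h0] using Nat.find_spec h)
  obtain ⟨k, hk⟩ := Nat.exists_eq_succ_of_ne_zero h0
  refine ⟨k, Nat.find_min h (by omega), ?_⟩
  rw [← End.mul_apply, ← pow_succ']
  have := Nat.find_spec h
  rwa [hk] at this

theorem exists_eq_natCast_of_mem_iSup_eigenspace {K V : Type*} [Field K] [AddCommGroup V]
    [Module K V] {D : End K V} {μ : K} {x : V} (hx : x ∈ D.eigenspace μ) (h0 : x ≠ 0)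
    (h : x ∈ ⨆ n : ℕ, D.eigenspace (n : K)) : ∃ n : ℕ, μ = n := by
  by_contra! hn
  have hd : Disjoint (D.eigenspace μ) (⨆ n : ℕ, D.eigenspace (n : K)) :=
    (D.eigenspaces_iSupIndep μ).mono_right
      (iSup_le fun n => le_iSup₂_of_le (n : K) (hn n).symm le_rfl)
  exact h0 (Submodule.disjoint_def.1 hd x hx h)

/-! ### Projections onto the components of a grading. -/

section GradedProjection

variable {ι K V : Type*} [Field K] [AddCommGroup V] [Module K V] {E : ι → Submodule K V}

theorem isCompl_iSup_ne (hE : iSupIndep E) (hT : ⨆ i, E i = ⊤) (i : ι) :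
    IsCompl (E i) (⨆ (j) (_ : j ≠ i), E j) := by
  refine ⟨hE i, codisjoint_iff.2 (top_le_iff.1 ?_)⟩
  rw [← hT]
  refine iSup_le fun j => ?_
  by_cases h : j = i
  · subst h; exact le_sup_left
  · exact le_sup_of_le_right (le_iSup₂_of_le j h le_rfl)

/-- The projection onto a member of an independent spanning family of subspaces. -/
noncomputable def gradedProj (hE : iSupIndep E) (hT : ⨆ i, E i = ⊤) (i : ι) : End K V :=
  (E i).projection _ (isCompl_iSup_ne hE hT i)

variable (hE : iSupIndep E) (hT : ⨆ i, E i = ⊤)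

theorem gradedProj_mem (i : ι) (x : V) : gradedProj hE hT i x ∈ E i :=
  Submodule.projection_apply_mem _ _

theorem gradedProj_of_mem {i : ι} {x : V} (hx : x ∈ E i) : gradedProj hE hT i x = x :=
  Submodule.projection_apply_of_mem_left _ hx

theorem gradedProj_of_mem_ne {i j : ι} {x : V} (hx : x ∈ E j) (h : j ≠ i) :
    gradedProj hE hT i x = 0 :=
  Submodule.projection_apply_of_mem_right _ ((le_iSup₂_of_le j h le_rfl : E j ≤ _) hx)

include hT in
theorem end_ext_of_iSup_eq_top {W : Type*} [AddCommGroup W] [Module K W] {f g : V →ₗ[K] W}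
    (h : ∀ i, ∀ x ∈ E i, f x = g x) : f = g := by
  ext x
  have hx : x ∈ ⨆ i, E i := hT ▸ Submodule.mem_top
  refine Submodule.iSup_induction E (motive := fun x => f x = g x) hx h (by simp) ?_
  intro x y hx hy
  simp [hx, hy]

/-- Injectivity of `σ` prevents two components from landing in the same degree. It is used with `σ =
id` for operators commuting with the grading and `σ = (· + 1)` for raising operators. -/
theorem gradedProj_apply_map {f : End K V} {σ : ι → ι} (hσ : Function.Injective σ)
    (hf : ∀ i, ∀ x ∈ E i, f x ∈ E (σ i)) (i : ι) (x : V) :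
    gradedProj hE hT (σ i) (f x) = f (gradedProj hE hT i x) := by
  suffices h : gradedProj hE hT (σ i) ∘ₗ f = f ∘ₗ gradedProj hE hT i from congr($h x)
  refine end_ext_of_iSup_eq_top hT fun j x hx => ?_
  by_cases h : j = i
  · subst h
    simp [gradedProj_of_mem hE hT hx, gradedProj_of_mem hE hT (hf _ x hx)]
  · simp [gradedProj_of_mem_ne hE hT hx h,
      gradedProj_of_mem_ne hE hT (hf _ x hx) (fun e => h (hσ e))]

theorem exists_finset_sum_gradedProj (x : V) :
    ∃ s : Finset ι, ∀ t : Finset ι, s ⊆ t → ∑ i ∈ t, gradedProj hE hT i x = x := by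
  classical
  have hx : x ∈ ⨆ i, E i := hT ▸ Submodule.mem_top
  refine Submodule.iSup_induction E (motive := fun x => ∃ s : Finset ι,
    ∀ t : Finset ι, s ⊆ t → ∑ i ∈ t, gradedProj hE hT i x = x) hx ?_ ⟨∅, by simp⟩ ?_
  · intro i x hx
    refine ⟨{i}, fun t ht => ?_⟩
    rw [Finset.sum_eq_single i, gradedProj_of_mem hE hT hx]
    · intro j _ hj
      exact gradedProj_of_mem_ne hE hT hx hj.symm
    · intro h
      exact absurd (ht (Finset.mem_singleton_self i)) h
  · rintro x y ⟨s, hs⟩ ⟨u, hu⟩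
    refine ⟨s ∪ u, fun t ht => ?_⟩
    simp only [map_add, Finset.sum_add_distrib]
    rw [hs t (Finset.union_subset_left ht), hu t (Finset.union_subset_right ht)]

theorem exists_gradedProj_ne_zero {x : V} (hx : x ≠ 0) : ∃ i, gradedProj hE hT i x ≠ 0 := by
  by_contra! h
  obtain ⟨s, hs⟩ := exists_finset_sum_gradedProj hE hT x
  exact hx (by rw [← hs s subset_rfl]; simp [h])

include hE hT in
theorem mem_of_gradedProj_ne_eq_zero {i : ι} {x : V}
    (h : ∀ j, j ≠ i → gradedProj hE hT j x = 0) : x ∈ E i := by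
  classical
  obtain ⟨s, hs⟩ := exists_finset_sum_gradedProj hE hT x
  rw [← hs s subset_rfl]
  refine Submodule.sum_mem _ fun j _ => ?_
  by_cases hj : j = i
  · subst hj; exact gradedProj_mem hE hT j x
  · rw [h j hj]; exact zero_mem _

end GradedProjection

/-! ### Eigenspaces of semisimple operators and generic members of a pencil. -/

section Semisimple

variable {K V : Type*} [Field K] [IsAlgClosed K] [AddCommGroup V] [Module K V]
  [FiniteDimensional K V]

theorem iSup_eigenspace_eq_top {D : End K V} (hD : D.IsSemisimple) :
    ⨆ μ, D.eigenspace μ = ⊤ := by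
  rw [← End.iSup_maxGenEigenspace_eq_top D]
  exact iSup_congr fun μ => (hD.isFinitelySemisimple.maxGenEigenspace_eq_eigenspace μ).symm

/-- The projection onto an eigenspace of a semisimple endomorphism. -/
noncomputable def eigenProj {D : End K V} (hD : D.IsSemisimple) (μ : K) : End K V :=
  gradedProj D.eigenspaces_iSupIndep (iSup_eigenspace_eq_top hD) μ

theorem eigenProj_mem {D : End K V} (hD : D.IsSemisimple) (μ : K) (x : V) :
    eigenProj hD μ x ∈ D.eigenspace μ := gradedProj_mem _ _ _ _

theorem apply_eigenProj {D : End K V} (hD : D.IsSemisimple) (μ : K) (x : V) :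
    D (eigenProj hD μ x) = μ • eigenProj hD μ x :=
  End.mem_eigenspace_iff.1 (eigenProj_mem hD μ x)

theorem eigenProj_of_mem {D : End K V} (hD : D.IsSemisimple) {μ : K} {x : V}
    (hx : x ∈ D.eigenspace μ) : eigenProj hD μ x = x := gradedProj_of_mem _ _ hx

theorem eigenProj_of_mem_ne {D : End K V} (hD : D.IsSemisimple) {μ ν : K} {x : V}
    (hx : x ∈ D.eigenspace μ) (h : μ ≠ ν) : eigenProj hD ν x = 0 := gradedProj_of_mem_ne _ _ hx h

theorem eigenProj_comm {D A : End K V} (hD : D.IsSemisimple) (h : Commute A D) (μ : K) (x : V) :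
    eigenProj hD μ (A x) = A (eigenProj hD μ x) := by
  refine gradedProj_apply_map (σ := id) _ _ Function.injective_id (fun ν y hy => ?_) μ x
  rw [End.mem_eigenspace_iff] at hy ⊢
  rw [id, ← map_smul, ← hy]
  exact congr($h.eq.symm y)

theorem eigenProj_shift {D A : End K V} (hD : D.IsSemisimple) (h : D * A - A * D = A)
    (μ : K) (x : V) : eigenProj hD (μ + 1) (A x) = A (eigenProj hD μ x) := by
  refine gradedProj_apply_map (σ := (· + 1)) _ _ (add_left_injective 1) (fun ν y hy => ?_) μ x
  rw [End.mem_eigenspace_iff] at hy ⊢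
  have := congr($h y)
  simp only [LinearMap.sub_apply, End.mul_apply, hy, map_smul] at this
  rw [add_smul, one_smul]
  nth_rewrite 3 [← this]
  abel

theorem mem_eigenspace_of_eigenProj {D : End K V} (hD : D.IsSemisimple) {x : V} {μ : K}
    (h : ∀ ν, ν ≠ μ → eigenProj hD ν x = 0) : x ∈ D.eigenspace μ :=
  mem_of_gradedProj_ne_eq_zero _ _ h

theorem iSup_eigenspace_inf_eigenspace_eq_top {D D' : End K V} (hD : D.IsSemisimple)
    (hD' : D'.IsSemisimple) (h : Commute D D') :
    ⨆ μ : K × K, D.eigenspace μ.1 ⊓ D'.eigenspace μ.2 = ⊤ := by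
  rw [eq_top_iff]
  intro x _
  obtain ⟨s, hs⟩ := exists_finset_sum_gradedProj D.eigenspaces_iSupIndep
    (iSup_eigenspace_eq_top hD) x
  rw [← hs s subset_rfl]
  refine Submodule.sum_mem _ fun μ _ => ?_
  set y := gradedProj D.eigenspaces_iSupIndep (iSup_eigenspace_eq_top hD) μ x
  have hy : y ∈ D.eigenspace μ := gradedProj_mem _ _ _ _
  obtain ⟨u, hu⟩ := exists_finset_sum_gradedProj D'.eigenspaces_iSupIndep
    (iSup_eigenspace_eq_top hD') y
  rw [← hu u subset_rfl]
  refine Submodule.sum_mem _ fun ν _ => ?_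
  refine Submodule.mem_iSup_of_mem (μ, ν) (Submodule.mem_inf.2 ⟨?_, eigenProj_mem hD' ν y⟩)
  have := eigenProj_comm hD' h ν y
  rw [End.mem_eigenspace_iff] at hy ⊢
  rw [hy, map_smul] at this
  exact this.symm

/-- The zero generalised eigenspace of a generic member of the pencil `A + c B`. -/
theorem exists_maxGenEigenspace_add_smul_le [CharZero K] {A B : End K V} (hAB : Commute A B)
    (hB : B.IsSemisimple) :
    ∃ c : K, (A + c • B).maxGenEigenspace 0 ≤ A.maxGenEigenspace 0 ⊓ LinearMap.ker B := by
  -- The values of `c` to avoid are those with `a + c b = 0` for an eigenvalue `a` of `A` and `b ≠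
  -- 0` of `B`. An eigenvalue `b = 0` adds only the harmless value `0`, by the convention for
  -- division.
  have hfin : (Set.image2 (fun a b => -a / b) {μ | A.HasEigenvalue μ}
      {μ | B.HasEigenvalue μ}).Finite :=
    (A.finite_hasEigenvalue).image2 _ B.finite_hasEigenvalue
  obtain ⟨c, hc⟩ := hfin.exists_notMem
  refine ⟨c, fun x hx => ?_⟩
  rw [End.mem_maxGenEigenspace, zero_smul, sub_zero] at hx
  obtain ⟨k, hk⟩ := hx
  -- On the `l`-eigenspace of `B` the operator `A + c B` acts as `A + c l`.
  have key : ∀ l : K, ((A + (c * l) • 1) ^ k) (eigenProj hB l x) = 0 := by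
    intro l
    have h1 : ∀ n : ℕ, ((A + c • B) ^ n) (eigenProj hB l x) =
        ((A + (c * l) • 1) ^ n) (eigenProj hB l x) := by
      intro n
      induction n with
      | zero => rfl
      | succ n ih =>
        have h2 : Commute ((A + (c * l) • (1 : End K V)) ^ n) B :=
          ((hAB.add_left ((Commute.one_left B).smul_left _)).pow_left n)
        have h3 := congr($h2.eq (eigenProj hB l x))
        simp only [End.mul_apply] at h3
        rw [pow_succ', End.mul_apply, ih, pow_succ', End.mul_apply]
        simp only [LinearMap.add_apply, LinearMap.smul_apply, End.one_apply]
        rw [← h3, apply_eigenProj, map_smul, smul_smul]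
    rw [← h1, ← eigenProj_comm hB, hk, map_zero]
    exact ((hAB.add_left ((Commute.refl B).smul_left c)).pow_left k)
  have hzero : ∀ l : K, l ≠ 0 → eigenProj hB l x = 0 := by
    intro l hl
    by_contra hne
    have hBl : B.HasEigenvalue l :=
      End.hasEigenvalue_of_hasEigenvector ⟨eigenProj_mem hB l x, hne⟩
    have hA : A.HasEigenvalue (-(c * l)) := by
      by_contra hA
      have hker : LinearMap.ker (A + (c * l) • (1 : End K V)) = ⊥ := by
        have : A.eigenspace (-(c * l)) = ⊥ := by
          simpa [End.HasEigenvalue, End.HasUnifEigenvalue] using hA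
        rw [End.eigenspace_def] at this
        simpa [Algebra.algebraMap_eq_smul_one] using this
      have hinj : Function.Injective (A + (c * l) • (1 : End K V)) := LinearMap.ker_eq_bot.1 hker
      have := (hinj.iterate k) (a₁ := eigenProj hB l x) (a₂ := 0)
      rw [← End.coe_pow] at this
      exact hne (this (by rw [key l, map_zero]))
    refine hc ⟨_, hA, l, hBl, ?_⟩
    field_simp
  have hx0 : x ∈ B.eigenspace 0 := mem_eigenspace_of_eigenProj hB hzero
  have hx1 : eigenProj hB 0 x = x := gradedProj_of_mem _ _ hx0
  refine Submodule.mem_inf.2 ⟨?_, by simpa [End.mem_eigenspace_iff] using hx0⟩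
  rw [End.mem_maxGenEigenspace]
  refine ⟨k, ?_⟩
  have := key 0
  rw [hx1] at this
  simpa using this

end Semisimple

/-! ### Operators raising degree by one, and limits of subspaces. -/

section Shift

variable {K V : Type*} [Field K] [AddCommGroup V] [Module K V]

theorem apply_mem_eigenspace_add_one {D A : End K V} (h : D * A - A * D = A) {μ : K} {x : V}
    (hx : x ∈ D.eigenspace μ) : A x ∈ D.eigenspace (μ + 1) := by
  rw [End.mem_eigenspace_iff] at hx ⊢
  have := congr($h x)
  simp only [LinearMap.sub_apply, End.mul_apply, hx, map_smul] at this
  rw [add_smul, one_smul]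
  nth_rewrite 3 [← this]
  abel

theorem pow_apply_mem_eigenspace_add {D A : End K V} (h : D * A - A * D = A) {μ : K} {x : V}
    (hx : x ∈ D.eigenspace μ) (n : ℕ) : (A ^ n) x ∈ D.eigenspace (μ + n) := by
  induction n with
  | zero => simpa using hx
  | succ n ih =>
    rw [pow_succ', End.mul_apply]
    have := apply_mem_eigenspace_add_one h ih
    push_cast
    rwa [← add_assoc]

variable [CharZero K] [FiniteDimensional K V]

/-- `[D, A^n] = n A^n`, so if no power vanished, the commutator with `D` would have infinitely many
eigenvalues on a finite-dimensional space. -/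
theorem isNilpotent_of_commutator_eq_self {D A : End K V} (h : D * A - A * D = A) :
    IsNilpotent A := by
  by_contra hA
  have hA' : ∀ n : ℕ, A ^ n ≠ 0 := fun n hn => hA ⟨n, hn⟩
  let T : End K (End K V) := LinearMap.mulLeft K D - LinearMap.mulRight K D
  have hT : ∀ n : ℕ, T (A ^ n) = (n : K) • A ^ n := by
    intro n
    induction n with
    | zero => simp [T]
    | succ n ih =>
      simp only [T, LinearMap.sub_apply, LinearMap.mulLeft_apply, LinearMap.mulRight_apply]
        at ih ⊢
      have h1 : D * A = A * D + A := by rw [← sub_eq_iff_eq_add']; exact h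
      have h2 : D * A ^ n = A ^ n * D + (n : K) • A ^ n := by
        rw [← sub_eq_iff_eq_add']; exact ih
      rw [pow_succ, ← mul_assoc, h2, add_mul, mul_assoc, h1, smul_mul_assoc]
      push_cast
      rw [add_smul, one_smul, mul_add, mul_assoc]
      abel
  have hev : ∀ n : ℕ, T.HasEigenvalue (n : K) := fun n =>
    End.hasEigenvalue_of_hasEigenvector ⟨End.mem_eigenspace_iff.2 (hT n), hA' n⟩
  exact (Set.infinite_of_injective_forall_mem Nat.cast_injective hev) T.finite_hasEigenvalue

/-- The sum of the spaces `A ^ i {x ∈ M | A ^ (i + 1) x = 0}`. -/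
def limSubmodule (A : End K V) (M : Submodule K V) : Submodule K V :=
  ⨆ i : ℕ, (M ⊓ LinearMap.ker (A ^ (i + 1))).map (A ^ i)

omit [CharZero K] [FiniteDimensional K V] in
theorem limSubmodule_le_ker (A : End K V) (M : Submodule K V) :
    limSubmodule A M ≤ LinearMap.ker A := by
  refine iSup_le fun i => ?_
  rintro _ ⟨x, hx, rfl⟩
  have := LinearMap.mem_ker.1 hx.2
  rw [pow_succ', End.mul_apply] at this
  exact this

omit [CharZero K] [FiniteDimensional K V] in
theorem limSubmodule_le_of_forall {A : End K V} {M N : Submodule K V} (hM : M ≤ N)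
    (hN : ∀ x ∈ N, A x ∈ N) : limSubmodule A M ≤ N := by
  refine iSup_le fun i => ?_
  rintro _ ⟨x, hx, rfl⟩
  have : ∀ n : ℕ, (A ^ n) x ∈ N := by
    intro n
    induction n with
    | zero => exact hM hx.1
    | succ n ih => rw [pow_succ', End.mul_apply]; exact hN _ ih
  exact this i

omit [CharZero K] [FiniteDimensional K V] in
theorem limSubmodule_le_iSup_eigenspace {D A : End K V} (h : D * A - A * D = A)
    {M : Submodule K V} (hM : M ≤ LinearMap.ker D) :
    limSubmodule A M ≤ ⨆ n : ℕ, D.eigenspace (n : K) := by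
  refine iSup_le fun i => ?_
  rintro _ ⟨x, hx, rfl⟩
  have hx0 : x ∈ D.eigenspace 0 := by
    rw [End.mem_eigenspace_iff, zero_smul]; exact hM hx.1
  have := pow_apply_mem_eigenspace_add h hx0 i
  rw [zero_add] at this
  exact Submodule.mem_iSup_of_mem i this

/-- With `M(i) = M ∩ ker A^(i+1)`, the piece `A^i M(i)` has dimension `dim M(i) - dim M(i-1)` and
lies in the eigenspace of `D` for `i`. The sum is therefore direct, and the dimensions telescope to
`dim M` because `A` is nilpotent. -/
theorem finrank_le_finrank_limSubmodule {D A : End K V} (h : D * A - A * D = A)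
    {M : Submodule K V} (hM : M ≤ LinearMap.ker D) :
    finrank K M ≤ finrank K (limSubmodule A M) := by
  let P : ℕ → Submodule K V := fun i => (M ⊓ LinearMap.ker (A ^ (i + 1))).map (A ^ i)
  have hP : ∀ i, P i ≤ D.eigenspace (i : K) := by
    rintro i _ ⟨x, hx, rfl⟩
    have hx0 : x ∈ D.eigenspace 0 := by
      rw [End.mem_eigenspace_iff, zero_smul]; exact hM hx.1
    simpa using pow_apply_mem_eigenspace_add h hx0 i
  have hind : iSupIndep P :=
    ((D.eigenspaces_iSupIndep).comp (f := fun n : ℕ => (n : K)) Nat.cast_injective).mono hP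
  have hstep : ∀ i : ℕ, finrank K (M ⊓ LinearMap.ker (A ^ (i + 1)) : Submodule K V) =
      finrank K (P i) + finrank K (M ⊓ LinearMap.ker (A ^ i) : Submodule K V) := by
    intro i
    have hle : LinearMap.ker (A ^ i) ≤ LinearMap.ker (A ^ (i + 1)) := by
      intro x hx
      rw [LinearMap.mem_ker] at hx ⊢
      rw [pow_succ', End.mul_apply, hx, map_zero]
    have h1 := finrank_map_add_finrank_inf_ker (A ^ i) (M ⊓ LinearMap.ker (A ^ (i + 1)))
    rw [inf_assoc, inf_eq_right.2 hle] at h1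
    exact h1.symm
  have hind2 : ∀ n : ℕ, finrank K (M ⊓ LinearMap.ker (A ^ n) : Submodule K V) ≤
      finrank K (⨆ i ∈ Finset.range n, P i : Submodule K V) := by
    intro n
    induction n with
    | zero =>
      have h0 : LinearMap.ker (A ^ 0) = ⊥ := by ext x; simp
      rw [h0, inf_bot_eq, finrank_bot]
      exact Nat.zero_le _
    | succ n ih =>
      have hdisj : Disjoint (P n) (⨆ i ∈ Finset.range n, P i) := by
        refine (hind n).mono_right (iSup₂_le fun j hj => ?_)
        exact le_iSup₂_of_le j (Finset.mem_range.1 hj).ne le_rfl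
      have h1 : (⨆ i ∈ Finset.range (n + 1), P i) = P n ⊔ ⨆ i ∈ Finset.range n, P i := by
        rw [Finset.range_add_one, Finset.iSup_insert]
      have h2 := Submodule.finrank_sup_add_finrank_inf_eq (P n) (⨆ i ∈ Finset.range n, P i)
      rw [hdisj.eq_bot, finrank_bot, add_zero] at h2
      rw [hstep, h1, h2]
      omega
  obtain ⟨n, hn⟩ := isNilpotent_of_commutator_eq_self h
  have h3 := hind2 n
  rw [hn, LinearMap.ker_zero, inf_top_eq] at h3
  exact h3.trans (Submodule.finrank_mono (iSup₂_le fun i _ => le_iSup P i))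

end Shift

/-! ### Alternating forms and duality for graded symmetric forms. -/

section Forms

variable {K V : Type*} [Field K] [AddCommGroup V] [Module K V] [FiniteDimensional K V]

open LinearMap (BilinForm)

/-- On a complement of the radical the form is nondegenerate with skew-symmetric matrix, and a skew
matrix of odd size has determinant zero. -/
theorem exists_finrank_eq_finrank_ker_add_two_mul [CharZero K] {B : BilinForm K V}
    (hB : ∀ x, B x x = 0) : ∃ k, finrank K V = finrank K (LinearMap.ker B) + 2 * k := by
  have hskew : ∀ x y, B x y = - B y x := fun x y => (LinearMap.IsAlt.neg hB y x).symm
  obtain ⟨W, hW⟩ := (LinearMap.ker B).exists_isCompl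
  have hW' : (B.restrict W).Nondegenerate := by
    have key : ∀ x ∈ W, (∀ y ∈ W, B x y = 0) → x = 0 := by
      intro x hx h
      have hk : x ∈ LinearMap.ker B := by
        rw [LinearMap.mem_ker]
        ext y
        obtain ⟨a, b, rfl, -⟩ := Submodule.existsUnique_add_of_isCompl hW y
        have ha : B a = 0 := a.2
        rw [map_add, hskew x a, ha, h b b.2]
        simp
      exact (Submodule.disjoint_def.1 hW.disjoint) x hk hx
    constructor
    · intro x h
      exact Subtype.ext (key x x.2 fun y hy => h ⟨y, hy⟩)
    · intro x h
      refine Subtype.ext (key x x.2 fun y hy => ?_)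
      rw [hskew, neg_eq_zero]
      exact h ⟨y, hy⟩
  rw [← Submodule.finrank_add_eq_of_isCompl hW]
  let b := finBasis K W
  have hdet := (BilinForm.nondegenerate_iff_det_ne_zero b).1 hW'
  set M := LinearMap.BilinForm.toMatrix b (B.restrict W)
  have hM : M.transpose = -M := by
    ext i j
    simp only [M, Matrix.transpose_apply, Matrix.neg_apply, LinearMap.BilinForm.toMatrix_apply]
    exact hskew _ _
  have h1 : M.det = (-1) ^ finrank K W * M.det := by
    conv_lhs => rw [← Matrix.det_transpose, hM, Matrix.det_neg, Fintype.card_fin]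
  have h2 : ((-1 : K)) ^ finrank K W = 1 := by
    have := mul_right_cancel₀ hdet ((one_mul _).trans h1)
    exact this.symm
  rcases Nat.even_or_odd (finrank K W) with ⟨k, hk⟩ | ho
  · exact ⟨k, by omega⟩
  · rw [ho.neg_one_pow] at h2
    exfalso
    have h3 : (2 : K) = 0 := by linear_combination (-1 : K) * h2
    exact two_ne_zero h3

variable {ι : Type*} [AddCommGroup ι] {E : ι → Submodule K V} {B : BilinForm K V}

omit [FiniteDimensional K V] in
theorem eq_zero_of_forall_mem_neg (hB : B.Nondegenerate) (hT : ⨆ i, E i = ⊤)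
    (hE : ∀ i j, i + j ≠ 0 → ∀ x ∈ E i, ∀ y ∈ E j, B x y = 0) {i : ι} {x : V} (hx : x ∈ E i)
    (h : ∀ y ∈ E (-i), B x y = 0) : x = 0 := by
  refine hB.1 x fun y => ?_
  have hy : y ∈ ⨆ i, E i := hT ▸ Submodule.mem_top
  refine Submodule.iSup_induction E (motive := fun y => B x y = 0) hy ?_ (by simp) ?_
  · intro j y hy
    by_cases hj : i + j = 0
    · rw [eq_neg_of_add_eq_zero_right hj] at hy
      exact h y hy
    · exact hE i j hj x hx y hy
  · intro y z hy hz
    simp [hy, hz]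

theorem finrank_le_of_forall_eq_zero (hB : B.Nondegenerate) (hs : ∀ x y, B x y = B y x)
    {U W : Submodule K V}
    (h : ∀ x ∈ U, (∀ y ∈ W, B x y = 0) → x = 0) : finrank K U ≤ finrank K W := by
  have h1 : Disjoint U (B.orthogonal W) := by
    rw [Submodule.disjoint_def]
    intro x hx hx'
    refine h x hx fun y hy => ?_
    rw [hs]
    exact hx' y hy
  have h2 := Submodule.finrank_add_finrank_le_of_disjoint h1
  rw [BilinForm.finrank_orthogonal hB] at h2
  have := Submodule.finrank_le W
  omega

/-- Duality: a skew operator raising degrees by `a` which is injective in degree `-(i + a)` maps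
degree `i` onto degree `i + a`. -/
theorem le_map_of_injOn_neg (hB : B.Nondegenerate) (hs : ∀ x y, B x y = B y x)
    (hT : ⨆ i, E i = ⊤)
    (hE : ∀ i j, i + j ≠ 0 → ∀ x ∈ E i, ∀ y ∈ E j, B x y = 0)
    {N : End K V} (hN : ∀ x y, B (N x) y = - B x (N y)) {a : ι}
    (hNE : ∀ i, ∀ x ∈ E i, N x ∈ E (i + a)) {i : ι}
    (hinj : ∀ x ∈ E (-(i + a)), N x = 0 → x = 0) : E (i + a) ≤ (E i).map N := by
  have hle : (E i).map N ≤ E (i + a) := by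
    rintro _ ⟨x, hx, rfl⟩
    exact hNE i x hx
  refine (Submodule.eq_of_le_of_finrank_le hle ?_).ge
  have h1 : finrank K (E (i + a)) ≤ finrank K (E (-(i + a))) :=
    finrank_le_of_forall_eq_zero hB hs fun x hx h => eq_zero_of_forall_mem_neg hB hT hE hx h
  -- An `x` of degree `-(i + a)` orthogonal to `N (E i)` has `N x` orthogonal to `E i`. Hence `N x =
  -- 0`, and `x = 0` by injectivity.
  refine h1.trans (finrank_le_of_forall_eq_zero hB hs fun x hx h => ?_)
  refine hinj x hx (eq_zero_of_forall_mem_neg hB hT hE (hNE _ x hx) fun y hy => ?_)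
  have e : -(-(i + a) + a) = i := by abel
  rw [e] at hy
  rw [hN, h _ ⟨y, hy, rfl⟩, neg_zero]

end Forms

/-! ### Translation between brackets, eigenspaces and centralizers; invariance of the Killing form.
-/

section Basic

variable {K L : Type*} [Field K] [LieRing L] [LieAlgebra K L]

theorem mem_eigenspace_ad {h x : L} {μ : K} :
    x ∈ (LieAlgebra.ad K L h).eigenspace μ ↔ ⁅h, x⁆ = μ • x := by
  rw [End.mem_eigenspace_iff, LieAlgebra.ad_apply]

theorem commute_ad {x y : L} (h : ⁅x, y⁆ = 0) :
    Commute (LieAlgebra.ad K L x) (LieAlgebra.ad K L y) := by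
  ext z
  simp only [End.mul_apply, LieAlgebra.ad_apply]
  rw [leibniz_lie, h, zero_lie, zero_add]

theorem ad_commutator {h e : L} (he : ⁅h, e⁆ = e) :
    LieAlgebra.ad K L h * LieAlgebra.ad K L e - LieAlgebra.ad K L e * LieAlgebra.ad K L h =
      LieAlgebra.ad K L e := by
  ext z
  simp only [LinearMap.sub_apply, End.mul_apply, LieAlgebra.ad_apply]
  rw [leibniz_lie h e, he, add_sub_cancel_right]

theorem lie_lie_comm {x y : L} (h : ⁅x, y⁆ = 0) (z : L) : ⁅x, ⁅y, z⁆⁆ = ⁅y, ⁅x, z⁆⁆ := by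
  rw [leibniz_lie, h, zero_lie, zero_add]

theorem lie_eq_zero_symm {x y : L} : ⁅x, y⁆ = 0 ↔ ⁅y, x⁆ = 0 := by
  rw [← lie_skew, neg_eq_zero]

theorem lie_smul_eigen {h x y : L} {a b : K} (hx : ⁅h, x⁆ = a • x) (hy : ⁅h, y⁆ = b • y) :
    ⁅h, ⁅x, y⁆⁆ = (a + b) • ⁅x, y⁆ := by
  rw [leibniz_lie, hx, hy, smul_lie, lie_smul, add_smul]

theorem mem_centre {l : LieSubalgebra K L} {x : L} :
    x ∈ centre K l ↔ x ∈ l ∧ ∀ y ∈ l, ⁅x, y⁆ = 0 := by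
  simp only [centre, Submodule.mem_map, LieSubmodule.mem_toSubmodule]
  constructor
  · rintro ⟨⟨x, hx⟩, h, rfl⟩
    refine ⟨hx, fun y hy => ?_⟩
    have := congrArg Subtype.val (h ⟨y, hy⟩)
    rw [← lie_skew, neg_eq_zero]
    exact this
  · rintro ⟨hx, h⟩
    refine ⟨⟨x, hx⟩, fun y => Subtype.ext ?_, rfl⟩
    have := h y y.2
    rw [← lie_skew, neg_eq_zero] at this
    exact this

theorem mem_centralizer_pair {a b x : L} :
    x ∈ centralizer K {a, b} ↔ ⁅x, a⁆ = 0 ∧ ⁅x, b⁆ = 0 := by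
  simp [mem_centralizer]

theorem mem_centralizer_triple {a b c x : L} :
    x ∈ centralizer K {a, b, c} ↔ ⁅x, a⁆ = 0 ∧ ⁅x, b⁆ = 0 ∧ ⁅x, c⁆ = 0 := by
  simp [mem_centralizer]

theorem mem_centralizer_singleton {a x : L} :
    x ∈ centralizer K {a} ↔ ⁅x, a⁆ = 0 := by
  simp [mem_centralizer]

theorem mem_engel_iff_maxGenEigenspace {x y : L} :
    y ∈ LieSubalgebra.engel K x ↔ y ∈ (LieAlgebra.ad K L x).maxGenEigenspace 0 := by
  rw [LieSubalgebra.mem_engel_iff, End.mem_maxGenEigenspace, zero_smul, sub_zero]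

/-- The joint eigenspaces of `ad h` and `ad h'`. -/
def jointEigenspace (h h' : L) (μ : K × K) : Submodule K L :=
  (LieAlgebra.ad K L h).eigenspace μ.1 ⊓ (LieAlgebra.ad K L h').eigenspace μ.2

theorem mem_jointEigenspace {h h' x : L} {μ : K × K} :
    x ∈ jointEigenspace h h' μ ↔ ⁅h, x⁆ = μ.1 • x ∧ ⁅h', x⁆ = μ.2 • x := by
  rw [jointEigenspace, Submodule.mem_inf, mem_eigenspace_ad, mem_eigenspace_ad]

theorem lim_eq_limSubmodule (e : L) (M : Submodule K L) :
    lim K e M = limSubmodule (LieAlgebra.ad K L e) M := rfl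

theorem killingForm_lie_left (x y z : L) :
    killingForm K L ⁅x, y⁆ z = - killingForm K L y ⁅x, z⁆ :=
  LieModule.traceForm_apply_lie_apply' K L L x y z

theorem killingForm_symm (x y : L) : killingForm K L x y = killingForm K L y x :=
  LieModule.traceForm_comm K L L x y

theorem killingForm_eq_zero_of_eigen {h x y : L} {a b : K} (hx : ⁅h, x⁆ = a • x)
    (hy : ⁅h, y⁆ = b • y) (hab : a + b ≠ 0) : killingForm K L x y = 0 := by
  have := killingForm_lie_left (K := K) h x y
  rw [hx, hy, map_smul, map_smul, LinearMap.smul_apply, smul_eq_mul, smul_eq_mul] at this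
  have h2 : (a + b) * killingForm K L x y = 0 := by linear_combination this
  exact (mul_eq_zero.1 h2).resolve_left hab

end Basic

/-! ### Killing duality of joint eigenspaces and parity of centralizer dimensions. -/

section Killing

variable {K L : Type*} [Field K] [IsAlgClosed K] [CharZero K] [LieRing L] [LieAlgebra K L]
  [Module.Finite K L] [LieAlgebra.IsKilling K L]

omit [CharZero K] [LieAlgebra.IsKilling K L] in
theorem iSup_jointEigenspace_eq_top {h h' : L} (hs : IsSemisimpleElement K h)
    (hs' : IsSemisimpleElement K h') (hc : ⁅h, h'⁆ = 0) :
    ⨆ μ : K × K, jointEigenspace h h' μ = ⊤ :=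
  iSup_eigenspace_inf_eigenspace_eq_top hs hs' (commute_ad hc)

omit [IsAlgClosed K] [CharZero K] [Module.Finite K L] [LieAlgebra.IsKilling K L] in
theorem killingForm_jointEigenspace_eq_zero {h h' : L} (i j : K × K) (hij : i + j ≠ 0) :
    ∀ x ∈ jointEigenspace h h' i, ∀ y ∈ jointEigenspace h h' j, killingForm K L x y = 0 := by
  intro x hx y hy
  rw [mem_jointEigenspace] at hx hy
  by_cases h1 : i.1 + j.1 = 0
  · have h2 : i.2 + j.2 ≠ 0 := fun h2 => hij (Prod.ext h1 h2)
    exact killingForm_eq_zero_of_eigen hx.2 hy.2 h2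
  · exact killingForm_eq_zero_of_eigen hx.1 hy.1 h1

omit [CharZero K] in
theorem eq_zero_of_killingForm_jointEigenspace {h h' : L} (hs : IsSemisimpleElement K h)
    (hs' : IsSemisimpleElement K h') (hc : ⁅h, h'⁆ = 0) {p q : K} {x : L}
    (hx : ⁅h, x⁆ = p • x) (hx' : ⁅h', x⁆ = q • x)
    (hy : ∀ y : L, ⁅h, y⁆ = (-p) • y → ⁅h', y⁆ = (-q) • y → killingForm K L x y = 0) : x = 0 :=
  eq_zero_of_forall_mem_neg (LieAlgebra.IsKilling.killingForm_nondegenerate K L)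
    (iSup_jointEigenspace_eq_top hs hs' hc) killingForm_jointEigenspace_eq_zero
    (i := (p, q)) (mem_jointEigenspace.2 ⟨hx, hx'⟩)
    fun y hy' => hy y (mem_jointEigenspace.1 hy').1 (mem_jointEigenspace.1 hy').2

omit [CharZero K] in
/-- Surjectivity of `ad e` between joint eigenspaces, deduced from injectivity in the opposite
degree. -/
theorem exists_lie_eq_of_injOn {h h' e : L} (hs : IsSemisimpleElement K h)
    (hs' : IsSemisimpleElement K h') (hc : ⁅h, h'⁆ = 0) (he : ⁅h, e⁆ = e) (he' : ⁅h', e⁆ = 0)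
    {p q : K}
    (hinj : ∀ x : L, ⁅h, x⁆ = (-(p + 1)) • x → ⁅h', x⁆ = (-q) • x → ⁅e, x⁆ = 0 → x = 0)
    {y : L} (hy : ⁅h, y⁆ = (p + 1) • y) (hy' : ⁅h', y⁆ = q • y) :
    ∃ x : L, ⁅h, x⁆ = p • x ∧ ⁅h', x⁆ = q • x ∧ ⁅e, x⁆ = y := by
  have h1 : ∀ i, ∀ x ∈ jointEigenspace (K := K) h h' i,
      LieAlgebra.ad K L e x ∈ jointEigenspace h h' (i + (1, 0)) := by
    intro i x hx
    rw [mem_jointEigenspace] at hx ⊢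
    rw [LieAlgebra.ad_apply]
    have h2 := lie_smul_eigen (a := (1 : K)) (by rw [one_smul]; exact he) hx.1
    have h3 := lie_smul_eigen (a := (0 : K)) (by rw [zero_smul]; exact he') hx.2
    refine ⟨?_, ?_⟩
    · rw [h2, add_comm]; rfl
    · rw [h3, add_comm]; rfl
  have := le_map_of_injOn_neg (LieAlgebra.IsKilling.killingForm_nondegenerate K L)
    killingForm_symm (iSup_jointEigenspace_eq_top hs hs' hc) killingForm_jointEigenspace_eq_zero
    (N := LieAlgebra.ad K L e) (fun x y => killingForm_lie_left e x y) (a := ((1 : K), (0 : K)))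
    h1 (i := (p, q)) (by
      intro x hx
      rw [mem_jointEigenspace] at hx
      have e2 : (-((p, q) + (1, 0)) : K × K).2 = -q := by simp
      rw [e2] at hx
      exact hinj x hx.1 hx.2)
  have hy2 : y ∈ jointEigenspace h h' ((p, q) + (1, 0)) := by
    rw [mem_jointEigenspace]
    have e2 : ((p, q) + (1, 0) : K × K).2 = q := by simp
    rw [e2]
    exact ⟨hy, hy'⟩
  obtain ⟨x, hx, hxy⟩ := this hy2
  have hx := mem_jointEigenspace.1 hx
  exact ⟨x, hx.1, hx.2, hxy⟩

omit [IsAlgClosed K] [LieAlgebra.IsKilling K L] in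
-- The form `κ([x,y],z)` on `P` is alternating by invariance. Since `κ` is nondegenerate on `P`, its
-- radical is the centralizer of `x` in `P`.
theorem exists_finrank_eq_finrank_ker_ad_add (P : LieSubalgebra K L)
    (hP : ∀ y ∈ P, (∀ z ∈ P, killingForm K L y z = 0) → y = 0) {x : L} (hx : x ∈ P) :
    ∃ k, finrank K P =
      finrank K (P.toSubmodule ⊓ LinearMap.ker (LieAlgebra.ad K L x) : Submodule K L) +
        2 * k := by
  let B : LinearMap.BilinForm K P :=
    ((killingForm K L).compl₁₂ (LieAlgebra.ad K L x) LinearMap.id).compl₁₂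
      P.toSubmodule.subtype P.toSubmodule.subtype
  have hB : ∀ y z : P, B y z = killingForm K L ⁅x, (y : L)⁆ z := fun y z => rfl
  have halt : ∀ y, B y y = 0 := by
    intro y
    rw [hB, LieModule.traceForm_apply_lie_apply, lie_self, map_zero]
  obtain ⟨k, hk⟩ := exists_finrank_eq_finrank_ker_add_two_mul halt
  refine ⟨k, ?_⟩
  have h2 : (LinearMap.ker B).map P.toSubmodule.subtype =
      P.toSubmodule ⊓ LinearMap.ker (LieAlgebra.ad K L x) := by
    ext y
    simp only [Submodule.mem_map, Submodule.mem_inf, LinearMap.mem_ker, LieAlgebra.ad_apply]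
    constructor
    · rintro ⟨y, hy, rfl⟩
      refine ⟨y.2, hP _ (P.lie_mem hx y.2) fun z hz => ?_⟩
      have := congr($hy ⟨z, hz⟩)
      exact this
    · rintro ⟨hy, hxy⟩
      refine ⟨⟨y, hy⟩, ?_, rfl⟩
      ext z
      rw [hB]
      simp only [hxy]
      simp
  rw [← h2, Submodule.finrank_map_subtype_eq]
  exact hk

/-- An Engel subalgebra of minimal dimension is a Cartan subalgebra. -/
theorem isCartanSubalgebra_engel_of_finrank_eq_rank {K L : Type*} [Field K] [Infinite K]
    [LieRing L] [LieAlgebra K L] [Module.Finite K L] {x : L}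
    (hx : finrank K (LieSubalgebra.engel K x) = LieAlgebra.rank K L) :
    (LieSubalgebra.engel K x).IsCartanSubalgebra := by
  refine ⟨?_, LieSubalgebra.normalizer_engel _ _⟩
  apply LieSubalgebra.isNilpotent_of_forall_le_engel
  intro y hy
  set Ex : {LieSubalgebra.engel K z | z ∈ LieSubalgebra.engel K x} :=
    ⟨LieSubalgebra.engel K x, x, LieSubalgebra.self_mem_engel _ _, rfl⟩
  suffices IsBot Ex from @this ⟨LieSubalgebra.engel K y, y, hy, rfl⟩
  have h : (finrank K L : Cardinal) ≤ Cardinal.mk K :=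
    Cardinal.natCast_le_aleph0.trans (Cardinal.infinite_iff.mp ‹Infinite K›)
  apply LieAlgebra.engel_isBot_of_isMin h (LieSubalgebra.engel K x) Ex le_rfl
  rintro ⟨_, y, hy, rfl⟩ hyx
  suffices finrank K (LieSubalgebra.engel K x) ≤ finrank K (LieSubalgebra.engel K y) by
    suffices LieSubalgebra.engel K y = LieSubalgebra.engel K x from this.ge
    apply LieSubalgebra.toSubmodule_injective
    exact Submodule.eq_of_le_of_finrank_le hyx this
  rw [hx]
  apply LieAlgebra.rank_le_finrank_engel

/-- The Engel subalgebra of a regular `x` is a Cartan subalgebra, hence abelian, so it is the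
centralizer of `x`; parity of codimension then applies. -/
theorem exists_finrank_eq_rank_add_two_mul :
    ∃ k, finrank K L = LieAlgebra.rank K L + 2 * k := by
  obtain ⟨x, hx⟩ := LieAlgebra.exists_isRegular K L
  rw [LieAlgebra.isRegular_iff_finrank_engel_eq_rank] at hx
  have := isCartanSubalgebra_engel_of_finrank_eq_rank hx
  have hab : IsLieAbelian (LieSubalgebra.engel K x) := inferInstance
  have hker : (LieSubalgebra.engel K x).toSubmodule = LinearMap.ker (LieAlgebra.ad K L x) := by
    ext y
    rw [LieSubalgebra.mem_toSubmodule]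
    constructor
    · intro hy
      exact congrArg Subtype.val
        (hab.trivial ⟨x, LieSubalgebra.self_mem_engel K x⟩ ⟨y, hy⟩)
    · intro hy
      rw [LieSubalgebra.mem_engel_iff]
      exact ⟨1, by simpa using hy⟩
  obtain ⟨k, hk⟩ := exists_finrank_eq_finrank_ker_ad_add (K := K) (L := L) ⊤
    (fun y _ hy => (LieAlgebra.IsKilling.killingForm_nondegenerate K L).1 y
      fun z => hy z (LieSubalgebra.mem_top z)) (LieSubalgebra.mem_top x)
  refine ⟨k, ?_⟩
  rw [LieSubalgebra.top_toSubmodule, top_inf_eq, ← hker] at hk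
  rw [← hx]
  rw [← finrank_top K L]
  exact hk

end Killing

/-! ### The dimension squeeze: regularity, limits and the centre. -/

/-- A commuting pair with an associated semisimple pair whose centralizer has dimension at most
`rank + 1`. -/
structure IsNearPrincipal (K : Type*) {L : Type*} [Field K] [LieRing L] [LieAlgebra K L]
    [Module.Finite K L] (e₁ e₂ h₁ h₂ : L) : Prop
    extends IsAssociatedSemisimplePair K e₁ e₂ h₁ h₂ where
  lie_eq_zero : ⁅e₁, e₂⁆ = 0
  finrank_le : finrank K (centralizer K {e₁, e₂}) ≤ LieAlgebra.rank K L + 1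

namespace IsNearPrincipal

variable {K L : Type*} [Field K] [IsAlgClosed K] [CharZero K] [LieRing L] [LieAlgebra K L]
  [Module.Finite K L] [LieAlgebra.IsKilling K L] {e₁ e₂ h₁ h₂ : L}

omit [IsAlgClosed K] [CharZero K] [LieAlgebra.IsKilling K L] in
theorem symm (S : IsNearPrincipal K e₁ e₂ h₁ h₂) : IsNearPrincipal K e₂ e₁ h₂ h₁ where
  semisimple₁ := S.semisimple₂
  semisimple₂ := S.semisimple₁
  comm := lie_eq_zero_symm.1 S.comm
  lie₁₁ := S.lie₂₂
  lie₁₂ := S.lie₂₁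
  lie₂₁ := S.lie₁₂
  lie₂₂ := S.lie₁₁
  lie_eq_zero := lie_eq_zero_symm.1 S.lie_eq_zero
  finrank_le := by rw [Set.pair_comm]; exact S.finrank_le

omit [IsAlgClosed K] [LieAlgebra.IsKilling K L] in
theorem isNilpotent_ad (S : IsNearPrincipal K e₁ e₂ h₁ h₂) :
    IsNilpotent (LieAlgebra.ad K L e₁) :=
  isNilpotent_of_commutator_eq_self (ad_commutator S.lie₁₁)

omit [IsAlgClosed K] [CharZero K] [LieAlgebra.IsKilling K L] in
theorem lim_le (S : IsNearPrincipal K e₁ e₂ h₁ h₂) :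
    lim K e₁ (centralizer K {h₁, h₂}).toSubmodule ≤ (centralizer K {e₁, h₂}).toSubmodule := by
  intro x hx
  rw [lim_eq_limSubmodule] at hx
  rw [LieSubalgebra.mem_toSubmodule, mem_centralizer_pair]
  constructor
  · rw [lie_eq_zero_symm]
    exact limSubmodule_le_ker _ _ hx
  · rw [lie_eq_zero_symm]
    refine (limSubmodule_le_of_forall (N := LinearMap.ker (LieAlgebra.ad K L h₂)) ?_ ?_) hx
    · intro y hy
      rw [LieSubalgebra.mem_toSubmodule, mem_centralizer_pair] at hy
      exact lie_eq_zero_symm.1 hy.2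
    · intro y hy
      rw [LinearMap.mem_ker, LieAlgebra.ad_apply] at hy ⊢
      rw [LieAlgebra.ad_apply, lie_lie_comm S.lie₂₁, hy, lie_zero]

omit [IsAlgClosed K] [LieAlgebra.IsKilling K L] in
theorem finrank_torus_le (S : IsNearPrincipal K e₁ e₂ h₁ h₂) :
    finrank K (centralizer K {h₁, h₂}) ≤ finrank K (centralizer K {e₁, h₂}) := by
  refine le_trans ?_ (Submodule.finrank_mono S.lim_le)
  refine finrank_le_finrank_limSubmodule (ad_commutator S.lie₁₁) fun x hx => ?_
  rw [LieSubalgebra.mem_toSubmodule, mem_centralizer_pair] at hx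
  exact lie_eq_zero_symm.1 hx.1

omit [IsAlgClosed K] [CharZero K] [LieAlgebra.IsKilling K L] in
theorem limSubmodule_centralizer_le (S : IsNearPrincipal K e₁ e₂ h₁ h₂) :
    limSubmodule (LieAlgebra.ad K L e₂) (centralizer K {e₁, h₂}).toSubmodule ≤
      (centralizer K {e₁, e₂}).toSubmodule := by
  intro x hx
  rw [LieSubalgebra.mem_toSubmodule, mem_centralizer_pair]
  constructor
  · rw [lie_eq_zero_symm]
    refine (limSubmodule_le_of_forall (N := LinearMap.ker (LieAlgebra.ad K L e₁)) ?_ ?_) hx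
    · intro y hy
      rw [LieSubalgebra.mem_toSubmodule, mem_centralizer_pair] at hy
      exact lie_eq_zero_symm.1 hy.1
    · intro y hy
      rw [LinearMap.mem_ker, LieAlgebra.ad_apply] at hy ⊢
      rw [LieAlgebra.ad_apply, lie_lie_comm S.lie_eq_zero, hy, lie_zero]
  · rw [lie_eq_zero_symm]
    exact limSubmodule_le_ker _ _ hx

omit [IsAlgClosed K] [LieAlgebra.IsKilling K L] in
-- Upper end of the squeeze: `lim_{e₂}` carries `𝔷(e₁,h₂)` into `𝔷(e₁,e₂)` without losing dimension.
theorem finrank_centralizer_le (S : IsNearPrincipal K e₁ e₂ h₁ h₂) :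
    finrank K (centralizer K {e₁, h₂}) ≤ LieAlgebra.rank K L + 1 := by
  refine le_trans ?_ S.finrank_le
  refine le_trans ?_ (Submodule.finrank_mono S.limSubmodule_centralizer_le)
  refine finrank_le_finrank_limSubmodule (ad_commutator S.lie₂₂) fun x hx => ?_
  rw [LieSubalgebra.mem_toSubmodule, mem_centralizer_pair] at hx
  exact lie_eq_zero_symm.1 hx.2

omit [LieAlgebra.IsKilling K L] in
-- Realizing `𝔱` as the centralizer of one element makes both the parity statement and the bound of
-- the rank by Engel subalgebras apply to it.
theorem exists_engel_eq (S : IsNearPrincipal K e₁ e₂ h₁ h₂) :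
    ∃ c : K, LieSubalgebra.engel K (h₁ + c • h₂) = centralizer K {h₁, h₂} ∧
      (centralizer K {h₁, h₂}).toSubmodule =
        LinearMap.ker (LieAlgebra.ad K L (h₁ + c • h₂)) := by
  obtain ⟨c, hc⟩ := exists_maxGenEigenspace_add_smul_le (commute_ad S.comm) S.semisimple₂
  rw [← map_smul, ← map_add] at hc
  have h1 : ∀ x, x ∈ LieSubalgebra.engel K (h₁ + c • h₂) → x ∈ centralizer K {h₁, h₂} := by
    intro x hx
    rw [mem_engel_iff_maxGenEigenspace] at hx
    have hx' := Submodule.mem_inf.1 (hc hx)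
    rw [S.semisimple₁.isFinitelySemisimple.maxGenEigenspace_eq_eigenspace, mem_eigenspace_ad,
      zero_smul, LinearMap.mem_ker, LieAlgebra.ad_apply] at hx'
    rw [mem_centralizer_pair]
    exact ⟨lie_eq_zero_symm.1 hx'.1, lie_eq_zero_symm.1 hx'.2⟩
  have h2 : ∀ x, x ∈ centralizer K {h₁, h₂} → ⁅h₁ + c • h₂, x⁆ = 0 := by
    intro x hx
    rw [mem_centralizer_pair] at hx
    rw [add_lie, smul_lie, lie_eq_zero_symm.1 hx.1, lie_eq_zero_symm.1 hx.2, smul_zero, add_zero]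
  have h3 : ∀ x, ⁅h₁ + c • h₂, x⁆ = 0 → x ∈ LieSubalgebra.engel K (h₁ + c • h₂) := by
    intro x hx
    rw [LieSubalgebra.mem_engel_iff]
    exact ⟨1, by simpa using hx⟩
  refine ⟨c, ?_, ?_⟩
  · ext x
    exact ⟨h1 x, fun hx => h3 x (h2 x hx)⟩
  · ext x
    rw [LinearMap.mem_ker, LieAlgebra.ad_apply]
    exact ⟨h2 x, fun hx => h1 x (h3 x hx)⟩

omit [CharZero K] in
theorem eq_zero_of_killingForm_levi (S : IsNearPrincipal K e₁ e₂ h₁ h₂) {y : L}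
    (hy : y ∈ centralizer K {h₂})
    (h : ∀ z ∈ centralizer K {h₂}, killingForm K L y z = 0) : y = 0 := by
  -- Taking `h₂` twice turns joint eigenspaces into eigenspaces of `ad h₂` alone.
  refine eq_zero_of_killingForm_jointEigenspace (p := 0) (q := 0) S.semisimple₂ S.semisimple₂
    (lie_self _) ?_ ?_ fun z hz _ => h z ?_
  · rw [zero_smul]; exact lie_eq_zero_symm.1 (mem_centralizer_singleton.1 hy)
  · rw [zero_smul]; exact lie_eq_zero_symm.1 (mem_centralizer_singleton.1 hy)
  · rw [neg_zero, zero_smul] at hz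
    exact mem_centralizer_singleton.2 (lie_eq_zero_symm.1 hz)

omit [IsAlgClosed K] [CharZero K] [Module.Finite K L] [LieAlgebra.IsKilling K L] in
theorem levi_inf_ker (x : L) :
    (centralizer K {h₂}).toSubmodule ⊓ LinearMap.ker (LieAlgebra.ad K L x) =
      (centralizer K {x, h₂}).toSubmodule := by
  ext y
  rw [Submodule.mem_inf, LieSubalgebra.mem_toSubmodule, LieSubalgebra.mem_toSubmodule,
    mem_centralizer_pair, mem_centralizer_singleton, LinearMap.mem_ker, LieAlgebra.ad_apply,
    lie_eq_zero_symm (x := x), and_comm]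

/-- Both dimensions lie between `rk` and `rk + 1`. Comparing with `dim 𝔤` shows `dim 𝔱 ≡ rk` mod 2,
and comparing with `dim 𝔩₂` shows `dim 𝔷(e₁,h₂) ≡ dim 𝔱`. -/
theorem finrank_torus_and_centralizer (S : IsNearPrincipal K e₁ e₂ h₁ h₂) :
    finrank K (centralizer K {h₁, h₂}) = LieAlgebra.rank K L ∧
      finrank K (centralizer K {e₁, h₂}) = LieAlgebra.rank K L := by
  obtain ⟨c, hc, hc'⟩ := S.exists_engel_eq
  have h1 : LieAlgebra.rank K L ≤ finrank K (centralizer K {h₁, h₂}) := by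
    rw [← hc]; exact LieAlgebra.rank_le_finrank_engel K _
  have h2 := S.finrank_torus_le
  have h3 := S.finrank_centralizer_le
  obtain ⟨k₁, hk₁⟩ := exists_finrank_eq_rank_add_two_mul (K := K) (L := L)
  obtain ⟨k₂, hk₂⟩ := exists_finrank_eq_finrank_ker_ad_add (K := K) (L := L) ⊤
    (fun y _ hy => (LieAlgebra.IsKilling.killingForm_nondegenerate K L).1 y
      fun z => hy z (LieSubalgebra.mem_top z)) (LieSubalgebra.mem_top (h₁ + c • h₂))
  rw [LieSubalgebra.top_toSubmodule, top_inf_eq, ← hc'] at hk₂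
  have hk₂' : finrank K L = finrank K (centralizer K {h₁, h₂}) + 2 * k₂ := by
    rw [← finrank_top K L]; exact hk₂
  obtain ⟨k₃, hk₃⟩ := exists_finrank_eq_finrank_ker_ad_add (K := K) (centralizer K {h₂})
    (fun y hy h => S.eq_zero_of_killingForm_levi hy h) (x := h₁)
    (mem_centralizer_singleton.2 S.comm)
  obtain ⟨k₄, hk₄⟩ := exists_finrank_eq_finrank_ker_ad_add (K := K) (centralizer K {h₂})
    (fun y hy h => S.eq_zero_of_killingForm_levi hy h) (x := e₁)
    (mem_centralizer_singleton.2 (lie_eq_zero_symm.1 S.lie₂₁))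
  rw [levi_inf_ker] at hk₃ hk₄
  have hk₃' : finrank K (centralizer K {h₂}) = finrank K (centralizer K {h₁, h₂}) + 2 * k₃ := hk₃
  have hk₄' : finrank K (centralizer K {h₂}) = finrank K (centralizer K {e₁, h₂}) + 2 * k₄ := hk₄
  omega

theorem lim_eq (S : IsNearPrincipal K e₁ e₂ h₁ h₂) :
    lim K e₁ (centralizer K {h₁, h₂}).toSubmodule = (centralizer K {e₁, h₂}).toSubmodule := by
  refine Submodule.eq_of_le_of_finrank_le S.lim_le ?_
  have h1 : finrank K (centralizer K {e₁, h₂}) = finrank K (centralizer K {h₁, h₂}) := by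
    rw [S.finrank_torus_and_centralizer.1, S.finrank_torus_and_centralizer.2]
  refine h1.le.trans ?_
  refine finrank_le_finrank_limSubmodule (ad_commutator S.lie₁₁) fun x hx => ?_
  rw [LieSubalgebra.mem_toSubmodule, mem_centralizer_pair] at hx
  exact lie_eq_zero_symm.1 hx.1

theorem isCartanSubalgebra_torus (S : IsNearPrincipal K e₁ e₂ h₁ h₂) :
    (centralizer K {h₁, h₂}).IsCartanSubalgebra := by
  obtain ⟨c, hc, -⟩ := S.exists_engel_eq
  rw [← hc]
  refine isCartanSubalgebra_engel_of_finrank_eq_rank ?_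
  rw [hc]
  exact S.finrank_torus_and_centralizer.1

theorem lie_eq_zero_of_mem_torus (S : IsNearPrincipal K e₁ e₂ h₁ h₂) {x y : L}
    (hx : x ∈ centralizer K {h₁, h₂}) (hy : y ∈ centralizer K {h₁, h₂}) : ⁅x, y⁆ = 0 := by
  have := S.isCartanSubalgebra_torus
  have hab : IsLieAbelian (centralizer K {h₁, h₂}) := inferInstance
  exact congrArg Subtype.val (hab.trivial ⟨x, hx⟩ ⟨y, hy⟩)

omit [IsAlgClosed K] [CharZero K] [Module.Finite K L] [LieAlgebra.IsKilling K L] in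
theorem coe_ad_pow (P : LieSubalgebra K L) (x y : P) (n : ℕ) :
    (((LieAlgebra.ad K P x ^ n) y : P) : L) = (LieAlgebra.ad K L (x : L) ^ n) (y : L) := by
  induction n with
  | zero => simp
  | succ n ih => rw [pow_succ', pow_succ', End.mul_apply, End.mul_apply, ← ih]; simp

omit [IsAlgClosed K] [CharZero K] [Module.Finite K L] [LieAlgebra.IsKilling K L] in
theorem mem_engel_coe_iff (P : LieSubalgebra K L) (x y : P) :
    y ∈ LieSubalgebra.engel K x ↔ (y : L) ∈ LieSubalgebra.engel K (x : L) := by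
  simp only [LieSubalgebra.mem_engel_iff, ← coe_ad_pow]
  exact exists_congr fun n => ⟨fun h => by rw [h]; rfl, fun h => Subtype.ext h⟩

/-- For `≤`, the Engel subalgebra of `h₁` in `𝔩₂` lies in `𝔱`. For `≥`, if `y` is regular in `𝔩₂`,
then for suitable `c` the Engel subalgebra of `y + c h₂` in `𝔤` lies in that of `y` in `𝔩₂`. -/
theorem rank_levi (S : IsNearPrincipal K e₁ e₂ h₁ h₂) :
    LieAlgebra.rank K (centralizer K {h₂}) = LieAlgebra.rank K L := by
  apply le_antisymm
  · have hh : h₁ ∈ centralizer K {h₂} := mem_centralizer_singleton.2 S.comm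
    refine (LieAlgebra.rank_le_finrank_engel K (⟨h₁, hh⟩ : centralizer K {h₂})).trans ?_
    rw [← S.finrank_torus_and_centralizer.1]
    have h1 : (LieSubalgebra.engel K (⟨h₁, hh⟩ : centralizer K {h₂})).toSubmodule.map
        (centralizer K {h₂}).toSubmodule.subtype ≤ (centralizer K {h₁, h₂}).toSubmodule := by
      rintro _ ⟨y, hy, rfl⟩
      have h2 := mem_engel_iff_maxGenEigenspace.1 ((mem_engel_coe_iff _ ⟨h₁, hh⟩ y).1 hy)
      rw [S.semisimple₁.isFinitelySemisimple.maxGenEigenspace_eq_eigenspace, mem_eigenspace_ad,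
        zero_smul] at h2
      exact mem_centralizer_pair.2 ⟨lie_eq_zero_symm.1 h2, mem_centralizer_singleton.1 y.2⟩
    have h3 := Submodule.finrank_mono h1
    rw [Submodule.finrank_map_subtype_eq] at h3
    exact h3
  · obtain ⟨y, hy⟩ := LieAlgebra.exists_isRegular K (centralizer K {h₂})
    rw [LieAlgebra.isRegular_iff_finrank_engel_eq_rank] at hy
    rw [← hy]
    obtain ⟨c, hc⟩ := exists_maxGenEigenspace_add_smul_le
      (commute_ad (K := K) (mem_centralizer_singleton.1 y.2)) S.semisimple₂
    rw [← map_smul, ← map_add] at hc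
    refine (LieAlgebra.rank_le_finrank_engel K ((y : L) + c • h₂)).trans ?_
    have h1 : (LieSubalgebra.engel K ((y : L) + c • h₂)).toSubmodule ≤
        (LieSubalgebra.engel K y).toSubmodule.map (centralizer K {h₂}).toSubmodule.subtype := by
      intro x hx
      rw [LieSubalgebra.mem_toSubmodule, mem_engel_iff_maxGenEigenspace] at hx
      obtain ⟨hx1, hx2⟩ := Submodule.mem_inf.1 (hc hx)
      rw [← mem_engel_iff_maxGenEigenspace] at hx1
      exact ⟨⟨x, mem_centralizer_singleton.2 (lie_eq_zero_symm.1 hx2)⟩,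
        (mem_engel_coe_iff _ y ⟨x, _⟩).2 hx1, rfl⟩
    have h3 := Submodule.finrank_mono h1
    rw [Submodule.finrank_map_subtype_eq] at h3
    exact h3

theorem isRegularNilpotentIn (S : IsNearPrincipal K e₁ e₂ h₁ h₂) :
    IsRegularNilpotentIn K (centralizer K {h₂}) e₁ where
  mem := mem_centralizer_singleton.2 (lie_eq_zero_symm.1 S.lie₂₁)
  nilpotent := S.isNilpotent_ad
  finrank_centralizer := by
    rw [S.rank_levi, ← S.finrank_torus_and_centralizer.2]
    have : centralizer K {h₂} ⊓ centralizer K {e₁} = centralizer K {e₁, h₂} := by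
      ext x
      rw [LieSubalgebra.mem_inf, mem_centralizer_pair, mem_centralizer_singleton,
        mem_centralizer_singleton, and_comm]
    rw [this]

/-- In the Levi subalgebra `𝔷(h₂)`, highest weight vectors for `e₁` have degree in `ℕ`. -/
theorem exists_natCast_of_lie_eq_zero (S : IsNearPrincipal K e₁ e₂ h₁ h₂) {x : L} {μ : K}
    (hx : x ≠ 0) (h1 : ⁅h₁, x⁆ = μ • x) (h2 : ⁅h₂, x⁆ = 0) (he : ⁅e₁, x⁆ = 0) :
    ∃ n : ℕ, μ = n := by
  refine exists_eq_natCast_of_mem_iSup_eigenspace (mem_eigenspace_ad.2 h1) hx ?_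
  have hx' : x ∈ (centralizer K {e₁, h₂}).toSubmodule :=
    mem_centralizer_pair.2 ⟨lie_eq_zero_symm.1 he, lie_eq_zero_symm.1 h2⟩
  rw [← S.lim_eq, lim_eq_limSubmodule] at hx'
  refine limSubmodule_le_iSup_eigenspace (ad_commutator S.lie₁₁) (fun y hy => ?_) hx'
  rw [LieSubalgebra.mem_toSubmodule, mem_centralizer_pair] at hy
  exact lie_eq_zero_symm.1 hy.1

/-- Applying `e₁` until just before the vector dies raises the degree by an integer and ends in a
highest weight vector. -/
theorem exists_intCast_of_lie_eq_smul (S : IsNearPrincipal K e₁ e₂ h₁ h₂) {x : L} {μ : K}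
    (hx : x ≠ 0) (h1 : ⁅h₁, x⁆ = μ • x) (h2 : ⁅h₂, x⁆ = 0) : ∃ n : ℤ, μ = n := by
  obtain ⟨k, hk, hk'⟩ := exists_pow_apply_ne_zero S.isNilpotent_ad hx
  have h3 := mem_eigenspace_ad.1
    (pow_apply_mem_eigenspace_add (ad_commutator S.lie₁₁) (mem_eigenspace_ad.2 h1) k)
  have h4 : ⁅h₂, (LieAlgebra.ad K L e₁ ^ k) x⁆ = 0 := by
    have := congr($(((commute_ad (K := K) S.lie₂₁).pow_right k).eq) x)
    simp only [End.mul_apply, LieAlgebra.ad_apply] at this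
    rw [this, h2, map_zero]
  obtain ⟨n, hn⟩ := S.exists_natCast_of_lie_eq_zero hk h3 h4 hk'
  exact ⟨n - k, by push_cast; rw [← hn]; ring⟩

/-- Surjectivity of `e₁` on the Levi subalgebra `𝔷(h₂)` in nonnegative degrees. -/
theorem exists_lie_eq_of_levi (S : IsNearPrincipal K e₁ e₂ h₁ h₂) (n : ℕ) {y : L}
    (h1 : ⁅h₁, y⁆ = ((n : K) + 1) • y) (h2 : ⁅h₂, y⁆ = 0) :
    ∃ x : L, ⁅h₁, x⁆ = (n : K) • x ∧ ⁅h₂, x⁆ = 0 ∧ ⁅e₁, x⁆ = y := by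
  obtain ⟨x, hx1, hx2, hx3⟩ := exists_lie_eq_of_injOn (p := (n : K)) (q := 0) S.semisimple₁
    S.semisimple₂ S.comm S.lie₁₁ S.lie₂₁ (y := y) (by
      intro x hx1 hx2 hx3
      by_contra hx
      rw [neg_zero, zero_smul] at hx2
      obtain ⟨m, hm⟩ := S.exists_natCast_of_lie_eq_zero hx hx1 hx2 hx3
      have : ((m + n + 1 : ℕ) : K) = 0 := by push_cast; rw [← hm]; ring
      exact absurd (Nat.cast_eq_zero.1 this) (by omega)) h1 (by rw [zero_smul, h2])
  exact ⟨x, hx1, by rw [hx2, zero_smul], hx3⟩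

theorem centralizer_eq_centre (S : IsNearPrincipal K e₁ e₂ h₁ h₂) :
    (centralizer K {e₁, h₁, h₂}).toSubmodule = centre K (centralizer K {h₂}) := by
  ext x
  rw [LieSubalgebra.mem_toSubmodule, mem_centre, mem_centralizer_triple,
    mem_centralizer_singleton]
  constructor
  swap
  · rintro ⟨hx, h⟩
    exact ⟨h e₁ (mem_centralizer_singleton.2 (lie_eq_zero_symm.1 S.lie₂₁)),
      h h₁ (mem_centralizer_singleton.2 S.comm), hx⟩
  rintro ⟨hxe, hx1, hx2⟩
  refine ⟨hx2, fun y hy => ?_⟩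
  rw [mem_centralizer_singleton] at hy
  have hxt : x ∈ centralizer K {h₁, h₂} := mem_centralizer_pair.2 ⟨hx1, hx2⟩
  have hnat : ∀ (n : ℕ) (y : L), ⁅h₁, y⁆ = (n : K) • y → ⁅h₂, y⁆ = 0 → ⁅x, y⁆ = 0 := by
    intro n
    induction n with
    | zero =>
      intro y hy1 hy2
      rw [Nat.cast_zero, zero_smul] at hy1
      exact S.lie_eq_zero_of_mem_torus hxt
        (mem_centralizer_pair.2 ⟨lie_eq_zero_symm.1 hy1, lie_eq_zero_symm.1 hy2⟩)
    | succ n ih =>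
      intro y hy1 hy2
      obtain ⟨z, hz1, hz2, rfl⟩ := S.exists_lie_eq_of_levi n (by push_cast at hy1; exact hy1) hy2
      rw [lie_lie_comm hxe, ih z hz1 hz2, lie_zero]
  have heig : ∀ (μ : K) (y : L), ⁅h₁, y⁆ = μ • y → ⁅h₂, y⁆ = 0 → ⁅x, y⁆ = 0 := by
    intro μ y hy1 hy2
    by_cases hy0 : y = 0
    · rw [hy0, lie_zero]
    obtain ⟨n, rfl⟩ := S.exists_intCast_of_lie_eq_smul hy0 hy1 hy2
    obtain ⟨m, rfl | rfl⟩ := Int.eq_nat_or_neg n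
    · exact hnat m y (by simpa using hy1) hy2
    -- In degree `-m`, the element `[x,y]` pairs only with degree `m`, where invariance moves `ad x`
    -- onto a vector it kills.
    · refine eq_zero_of_killingForm_jointEigenspace S.semisimple₁ S.semisimple₂ S.comm
        (p := -(m : K)) (q := 0) ?_ ?_ fun z hz1 hz2 => ?_
      · rw [lie_lie_comm (lie_eq_zero_symm.1 hx1), hy1, lie_smul]
        simp
      · rw [lie_lie_comm (lie_eq_zero_symm.1 hx2), hy2, lie_zero, zero_smul]
      · rw [killingForm_lie_left, hnat m z (by simpa using hz1) (by simpa using hz2), map_zero,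
          neg_zero]
  obtain ⟨s, hs⟩ := exists_finset_sum_gradedProj (LieAlgebra.ad K L h₁).eigenspaces_iSupIndep
    (iSup_eigenspace_eq_top S.semisimple₁) y
  rw [← hs s subset_rfl, lie_sum]
  refine Finset.sum_eq_zero fun μ _ => heig μ _ (mem_eigenspace_ad.1 (gradedProj_mem _ _ _ _)) ?_
  have := eigenProj_comm S.semisimple₁ (commute_ad (lie_eq_zero_symm.1 S.comm)) μ y
  rw [LieAlgebra.ad_apply, LieAlgebra.ad_apply, lie_eq_zero_symm.1 hy, map_zero] at this
  exact this.symm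

end IsNearPrincipal

/-! ### Triple centralizers: consequences of a strict inequality. -/

namespace IsNearPrincipal

variable {K L : Type*} [Field K] [IsAlgClosed K] [CharZero K] [LieRing L] [LieAlgebra K L]
  [Module.Finite K L] [LieAlgebra.IsKilling K L] {e₁ e₂ h₁ h₂ : L}

omit [IsAlgClosed K] [LieAlgebra.IsKilling K L] in
theorem finrank_triple_le (S : IsNearPrincipal K e₁ e₂ h₁ h₂) :
    finrank K (centralizer K {e₁, h₁, h₂}) ≤ finrank K (centralizer K {e₁, h₁, e₂}) := by
  refine (finrank_le_finrank_limSubmodule (M := (centralizer K {e₁, h₁, h₂}).toSubmodule)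
    (ad_commutator S.lie₂₂) ?_).trans (Submodule.finrank_mono ?_)
  · intro x hx
    exact lie_eq_zero_symm.1 (mem_centralizer_triple.1 hx).2.2
  · intro x hx
    refine mem_centralizer_triple.2 ⟨?_, ?_, ?_⟩
    · rw [lie_eq_zero_symm]
      refine (limSubmodule_le_of_forall (N := LinearMap.ker (LieAlgebra.ad K L e₁)) ?_ ?_) hx
      · intro y hy
        exact lie_eq_zero_symm.1 (mem_centralizer_triple.1 hy).1
      · intro y hy
        rw [LinearMap.mem_ker, LieAlgebra.ad_apply] at hy ⊢
        rw [LieAlgebra.ad_apply, lie_lie_comm S.lie_eq_zero, hy, lie_zero]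
    · rw [lie_eq_zero_symm]
      refine (limSubmodule_le_of_forall (N := LinearMap.ker (LieAlgebra.ad K L h₁)) ?_ ?_) hx
      · intro y hy
        exact lie_eq_zero_symm.1 (mem_centralizer_triple.1 hy).2.1
      · intro y hy
        rw [LinearMap.mem_ker, LieAlgebra.ad_apply] at hy ⊢
        rw [LieAlgebra.ad_apply, lie_lie_comm S.lie₁₂, hy, lie_zero]
    · rw [lie_eq_zero_symm]
      exact limSubmodule_le_ker _ _ hx

/-- If the inequality of `finrank_triple_le` is strict, then the degrees of the highest weight
vectors in `𝔷(e₁, e₂)` are natural numbers. -/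
theorem exists_natCast_of_lt_aux (S : IsNearPrincipal K e₁ e₂ h₁ h₂)
    (hlt : finrank K (centralizer K {e₁, h₁, h₂}) < finrank K (centralizer K {e₁, h₁, e₂}))
    {x : L} {μ : K} (hx : x ≠ 0) (h1 : ⁅h₁, x⁆ = μ • x) (he₁ : ⁅e₁, x⁆ = 0) (he₂ : ⁅e₂, x⁆ = 0) :
    ∃ n : ℕ, μ = n := by
  by_cases hμ : μ = 0
  · exact ⟨0, by simp [hμ]⟩
  set D := LieAlgebra.ad K L h₁ with hD
  have hdisj := disjoint_ker_range_of_isSemisimple S.semisimple₁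
  set Z := (centralizer K {e₁, e₂}).toSubmodule
  set A := (centralizer K {e₁, h₂}).toSubmodule
  have hZ0 : (centralizer K {e₁, h₁, e₂}).toSubmodule = Z ⊓ LinearMap.ker D := by
    ext y
    rw [Submodule.mem_inf, LieSubalgebra.mem_toSubmodule, LieSubalgebra.mem_toSubmodule,
      mem_centralizer_triple, mem_centralizer_pair, LinearMap.mem_ker, LieAlgebra.ad_apply,
      lie_eq_zero_symm (x := h₁)]
    tauto
  have hA0 : (centralizer K {e₁, h₁, h₂}).toSubmodule = A ⊓ LinearMap.ker D := by
    ext y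
    rw [Submodule.mem_inf, LieSubalgebra.mem_toSubmodule, LieSubalgebra.mem_toSubmodule,
      mem_centralizer_triple, mem_centralizer_pair, LinearMap.mem_ker, LieAlgebra.ad_apply,
      lie_eq_zero_symm (x := h₁)]
    tauto
  have hZle : finrank K (Z ⊓ LinearMap.ker D : Submodule K L) +
      finrank K (Z ⊓ LinearMap.range D : Submodule K L) ≤ finrank K Z := by
    rw [← Submodule.finrank_sup_add_finrank_inf_eq,
      (hdisj.mono inf_le_right inf_le_right).eq_bot, finrank_bot, add_zero]
    exact Submodule.finrank_mono (sup_le inf_le_left inf_le_left)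
  have hAle : finrank K A ≤ finrank K (A ⊓ LinearMap.ker D : Submodule K L) +
      finrank K (A ⊓ LinearMap.range D : Submodule K L) := by
    rw [← finrank_map_add_finrank_inf_ker D A, add_comm]
    gcongr
    refine Submodule.finrank_mono (le_inf ?_ LinearMap.map_le_range)
    rintro _ ⟨y, hy, rfl⟩
    have hy' := mem_centralizer_pair.1 hy
    refine mem_centralizer_pair.2 ⟨?_, ?_⟩
    · rw [LieAlgebra.ad_apply, lie_lie, hy'.1, ← lie_skew, S.lie₁₁, zero_lie, hy'.1,
        neg_zero, sub_zero]
    · rw [LieAlgebra.ad_apply, lie_lie, hy'.2, S.comm, lie_zero, lie_zero, sub_zero]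
  have hA : finrank K A = LieAlgebra.rank K L := S.finrank_torus_and_centralizer.2
  have hZ : finrank K Z ≤ LieAlgebra.rank K L + 1 := S.finrank_le
  -- Here `range D` is the part of nonzero `h₁`-degree. The degree-zero part of `Z` exceeds that of
  -- `A` by at least 1, while `dim Z ≤ dim A + 1`; so in nonzero degrees `Z` is no larger than `A`
  -- and is exhausted by the limit.
  have hlim : limSubmodule (LieAlgebra.ad K L e₂) (A ⊓ LinearMap.range D) =
      Z ⊓ LinearMap.range D := by
    refine Submodule.eq_of_le_of_finrank_le ?_ ?_
    · refine le_inf ?_ ?_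
      · intro y hy
        refine mem_centralizer_pair.2 ⟨?_, lie_eq_zero_symm.1 (limSubmodule_le_ker _ _ hy)⟩
        rw [lie_eq_zero_symm]
        refine (limSubmodule_le_of_forall (N := LinearMap.ker (LieAlgebra.ad K L e₁)) ?_ ?_) hy
        · intro y hy
          exact lie_eq_zero_symm.1 (mem_centralizer_pair.1 hy.1).1
        · intro y hy
          rw [LinearMap.mem_ker, LieAlgebra.ad_apply] at hy ⊢
          rw [LieAlgebra.ad_apply, lie_lie_comm S.lie_eq_zero, hy, lie_zero]
      · refine limSubmodule_le_of_forall inf_le_right ?_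
        rintro _ ⟨y, rfl⟩
        refine ⟨⁅e₂, y⁆, ?_⟩
        rw [hD, LieAlgebra.ad_apply, LieAlgebra.ad_apply, LieAlgebra.ad_apply,
          lie_lie_comm S.lie₁₂]
    · have h3 : finrank K (A ⊓ LinearMap.range D : Submodule K L) ≤ _ :=
        finrank_le_finrank_limSubmodule (ad_commutator S.lie₂₂) (fun y hy =>
          lie_eq_zero_symm.1 (mem_centralizer_pair.1 hy.1).2)
      have h4 : finrank K (Z ⊓ LinearMap.ker D : Submodule K L) =
        finrank K (centralizer K {e₁, h₁, e₂}) := by rw [← hZ0]; rfl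
      have h5 : finrank K (A ⊓ LinearMap.ker D : Submodule K L) =
        finrank K (centralizer K {e₁, h₁, h₂}) := by rw [← hA0]; rfl
      omega
  have hxZ : x ∈ Z ⊓ LinearMap.range D := by
    refine Submodule.mem_inf.2
      ⟨mem_centralizer_pair.2 ⟨lie_eq_zero_symm.1 he₁, lie_eq_zero_symm.1 he₂⟩, μ⁻¹ • x, ?_⟩
    rw [map_smul, hD, LieAlgebra.ad_apply, h1, smul_smul, inv_mul_cancel₀ hμ, one_smul]
  rw [← hlim] at hxZ
  refine exists_eq_natCast_of_mem_iSup_eigenspace (mem_eigenspace_ad.2 h1) hx ?_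
  -- `A = lim_{e₁} 𝔱` has degrees in `ℕ`, and `ad e₂` preserves the `h₁`-degree.
  refine (limSubmodule_le_of_forall (N := ⨆ n : ℕ, (LieAlgebra.ad K L h₁).eigenspace (n : K))
    ?_ ?_) hxZ
  · refine inf_le_left.trans ?_
    change (centralizer K {e₁, h₂}).toSubmodule ≤ _
    rw [← S.lim_eq]
    exact limSubmodule_le_iSup_eigenspace (ad_commutator S.lie₁₁) fun y hy =>
      lie_eq_zero_symm.1 (mem_centralizer_pair.1 hy).1
  · intro y hy
    refine Submodule.iSup_induction _
      (motive := fun y => LieAlgebra.ad K L e₂ y ∈ _) hy ?_ (by simp) ?_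
    · intro n y hy
      refine Submodule.mem_iSup_of_mem n ?_
      rw [mem_eigenspace_ad] at hy ⊢
      rw [LieAlgebra.ad_apply, lie_lie_comm S.lie₁₂, hy, lie_smul]
    · intro y z hy hz
      rw [map_add]
      exact add_mem hy hz

/-- Powers of `ad e₂` preserve both the `h₁`-degree and `𝔷(e₁)`, and move a nonzero vector into
`𝔷(e₁,e₂)`. -/
theorem exists_natCast_of_lt (S : IsNearPrincipal K e₁ e₂ h₁ h₂)
    (hlt : finrank K (centralizer K {e₁, h₁, h₂}) < finrank K (centralizer K {e₁, h₁, e₂}))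
    {x : L} {μ : K} (hx : x ≠ 0) (h1 : ⁅h₁, x⁆ = μ • x) (he₁ : ⁅e₁, x⁆ = 0) :
    ∃ n : ℕ, μ = n := by
  obtain ⟨k, hk, hk'⟩ := exists_pow_apply_ne_zero S.symm.isNilpotent_ad hx
  refine S.exists_natCast_of_lt_aux hlt hk ?_ ?_ hk'
  · have := congr($(((commute_ad (K := K) S.lie₁₂).pow_right k).eq) x)
    simp only [End.mul_apply, LieAlgebra.ad_apply] at this
    rw [this, h1, map_smul]
  · have := congr($(((commute_ad (K := K) S.lie_eq_zero).pow_right k).eq) x)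
    simp only [End.mul_apply, LieAlgebra.ad_apply] at this
    rw [this, he₁, map_zero]

theorem exists_intCast_of_lt (S : IsNearPrincipal K e₁ e₂ h₁ h₂)
    (hlt : finrank K (centralizer K {e₁, h₁, h₂}) < finrank K (centralizer K {e₁, h₁, e₂}))
    {x : L} {μ : K} (hx : x ≠ 0) (h1 : ⁅h₁, x⁆ = μ • x) : ∃ n : ℤ, μ = n := by
  obtain ⟨k, hk, hk'⟩ := exists_pow_apply_ne_zero S.isNilpotent_ad hx
  have h3 := mem_eigenspace_ad.1
    (pow_apply_mem_eigenspace_add (ad_commutator S.lie₁₁) (mem_eigenspace_ad.2 h1) k)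
  obtain ⟨n, hn⟩ := S.exists_natCast_of_lt hlt hk h3 hk'
  exact ⟨n - k, by push_cast; rw [← hn]; ring⟩

theorem exists_lie_eq_of_lt (S : IsNearPrincipal K e₁ e₂ h₁ h₂)
    (hlt : finrank K (centralizer K {e₁, h₁, h₂}) < finrank K (centralizer K {e₁, h₁, e₂}))
    (n : ℕ) {y : L} (h1 : ⁅h₁, y⁆ = ((n : K) + 1) • y) :
    ∃ x : L, ⁅h₁, x⁆ = (n : K) • x ∧ ⁅e₁, x⁆ = y := by
  -- With `0` as second semisimple element the bigrading reduces to the grading by `h₁`, so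
  -- surjectivity is obtained on all of `𝔤`.
  have h0 : IsSemisimpleElement K (0 : L) := by
    rw [IsSemisimpleElement, map_zero]; exact End.isSemisimple_zero
  obtain ⟨x, hx1, hx2, hx3⟩ := exists_lie_eq_of_injOn (h' := (0 : L)) (p := (n : K)) (q := 0)
    S.semisimple₁ h0 (lie_zero _) S.lie₁₁ (zero_lie _) (y := y) (by
      intro x hx1 hx2 hx3
      by_contra hx
      obtain ⟨m, hm⟩ := S.exists_natCast_of_lt hlt hx hx1 hx3
      have : ((m + n + 1 : ℕ) : K) = 0 := by push_cast; rw [← hm]; ring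
      exact absurd (Nat.cast_eq_zero.1 this) (by omega)) h1 (by rw [zero_smul, zero_lie])
  exact ⟨x, hx1, hx3⟩

omit [IsAlgClosed K] [Module.Finite K L] [LieAlgebra.IsKilling K L] in
-- In the Leibniz expansion of `(ad e)^(i+j) [x,y] = 0` only the term `(i,j)` survives, with a
-- nonzero binomial coefficient. Thus limits of abelian subspaces are abelian.
theorem lie_pow_pow_eq_zero {e x y : L} (hxy : ⁅x, y⁆ = 0) (i j : ℕ)
    (hx : (LieAlgebra.ad K L e ^ (i + 1)) x = 0) (hy : (LieAlgebra.ad K L e ^ (j + 1)) y = 0) :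
    ⁅(LieAlgebra.ad K L e ^ i) x, (LieAlgebra.ad K L e ^ j) y⁆ = 0 := by
  set D := LieAlgebra.ad K L e
  have hvan : ∀ {z : L} {a b : ℕ}, (D ^ (a + 1)) z = 0 → a < b → (D ^ b) z = 0 := by
    intro z a b hz hab
    obtain ⟨c, rfl⟩ := Nat.exists_eq_add_of_lt hab
    rw [show a + c + 1 = c + (a + 1) by ring, pow_add, End.mul_apply, hz, map_zero]
  have h1 := LieAlgebra.ad_pow_lie (R := K) e x y (i + j)
  rw [hxy, map_zero, Finset.sum_eq_single (i, j)] at h1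
  · have h2 : ((i + j).choose i : K) ≠ 0 :=
      Nat.cast_ne_zero.2 (Nat.choose_pos (Nat.le_add_right i j)).ne'
    have h3 : ((i + j).choose i : K) • ⁅(D ^ i) x, (D ^ j) y⁆ = 0 := by
      rw [Nat.cast_smul_eq_nsmul]; exact h1.symm
    exact (smul_eq_zero.1 h3).resolve_left h2
  · rintro ⟨a, b⟩ hab hne
    rw [Finset.HasAntidiagonal.mem_antidiagonal] at hab
    simp only at hab ⊢
    rcases lt_trichotomy a i with h | h | h
    · rw [hvan hy (by omega : j < b), lie_zero, smul_zero]
    · exact absurd (Prod.ext h (by simp only; omega)) hne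
    · rw [hvan hx h, zero_lie, smul_zero]
  · intro h
    exact absurd (Finset.HasAntidiagonal.mem_antidiagonal.2 (rfl : (i, j).1 + (i, j).2 = i + j)) h

theorem lie_eq_zero_of_mem_centralizer (S : IsNearPrincipal K e₁ e₂ h₁ h₂) {x y : L}
    (hx : x ∈ centralizer K {e₁, h₂}) (hy : y ∈ centralizer K {e₁, h₂}) : ⁅x, y⁆ = 0 := by
  have hlim := S.lim_eq
  rw [lim_eq_limSubmodule, limSubmodule] at hlim
  rw [← LieSubalgebra.mem_toSubmodule, ← hlim] at hx hy
  refine Submodule.iSup_induction _ (motive := fun x => ⁅x, y⁆ = 0) hx ?_ (zero_lie _)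
    (fun a b ha hb => by rw [add_lie, ha, hb, add_zero])
  rintro i _ ⟨x, hx, rfl⟩
  refine Submodule.iSup_induction _ (motive := fun y => ⁅_, y⁆ = 0) hy ?_ (lie_zero _)
    (fun a b ha hb => by rw [lie_add, ha, hb, add_zero])
  rintro j _ ⟨y, hy, rfl⟩
  exact lie_pow_pow_eq_zero (S.lie_eq_zero_of_mem_torus hx.1 hy.1) i j hx.2 hy.2

omit [CharZero K] [LieAlgebra.IsKilling K L] in
theorem killingForm_eigenProj_zero {h y z : L} (hs : IsSemisimpleElement K h)
    (hy : ⁅h, y⁆ = 0) :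
    killingForm K L (eigenProj hs 0 z) y = killingForm K L z y := by
  suffices H : ((killingForm K L).flip y) ∘ₗ (eigenProj hs 0) = (killingForm K L).flip y from
    congr($H z)
  refine end_ext_of_iSup_eq_top (iSup_eigenspace_eq_top hs) fun μ x hx => ?_
  by_cases hμ : μ = 0
  · subst hμ
    rw [LinearMap.comp_apply, eigenProj_of_mem hs hx]
  · rw [LinearMap.comp_apply, eigenProj_of_mem_ne hs hx hμ, map_zero]
    exact (killingForm_eq_zero_of_eigen (mem_eigenspace_ad.1 hx)
      (b := 0) (by rw [zero_smul, hy]) (by simpa using hμ)).symm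

omit [CharZero K] in
/-- In `𝔷(h₂)`, the image of `ad e₁` is the orthogonal complement of its kernel. -/
theorem exists_lie_eq_of_killingForm_eq_zero (S : IsNearPrincipal K e₁ e₂ h₁ h₂) {y : L}
    (hy : ⁅h₂, y⁆ = 0) (h : ∀ z ∈ centralizer K {e₁, h₂}, killingForm K L z y = 0) :
    ∃ x : L, ⁅h₂, x⁆ = 0 ∧ ⁅e₁, x⁆ = y := by
  set U : Submodule K L := (LinearMap.ker (LieAlgebra.ad K L h₂)).map (LieAlgebra.ad K L e₁)
  suffices hU : y ∈ U by
    obtain ⟨x, hx, rfl⟩ := hU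
    exact ⟨x, hx, rfl⟩
  -- It suffices that every `z` orthogonal to `U` be orthogonal to `y`. Only the `h₂`-degree zero
  -- component of `z` matters, and orthogonality to `U` forces `e₁` to kill it.
  rw [← LinearMap.BilinForm.orthogonal_orthogonal
    (LieAlgebra.IsKilling.killingForm_nondegenerate K L)
    (LieModule.traceForm_isSymm K L L).isRefl U]
  intro z hz
  change killingForm K L z y = 0
  rw [← killingForm_eigenProj_zero S.semisimple₂ hy]
  refine h _ (mem_centralizer_pair.2 ⟨?_, ?_⟩)
  · rw [lie_eq_zero_symm]
    have h1 := eigenProj_comm S.semisimple₂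
      (commute_ad (K := K) (lie_eq_zero_symm.1 S.lie₂₁)) 0 z
    rw [LieAlgebra.ad_apply, LieAlgebra.ad_apply] at h1
    rw [← h1]
    refine S.eq_zero_of_killingForm_levi ?_ fun w hw => ?_
    · rw [mem_centralizer_singleton, lie_eq_zero_symm]
      have := apply_eigenProj S.semisimple₂ 0 ⁅e₁, z⁆
      rwa [zero_smul] at this
    · have hw' := lie_eq_zero_symm.1 (mem_centralizer_singleton.1 hw)
      rw [killingForm_eigenProj_zero S.semisimple₂ hw', killingForm_lie_left, neg_eq_zero,
        killingForm_symm]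
      exact hz _ ⟨w, hw', rfl⟩
  · rw [lie_eq_zero_symm]
    have := apply_eigenProj S.semisimple₂ 0 z
    rwa [zero_smul] at this

/-- Write `w = [e₁,η]` with `η` of degree 0. As `𝔷(e₂,h₁)` is abelian and contains `x`, it is
orthogonal to `[x,η]`, so `[x,η] = [e₂,ξ]` with `ξ` of degree 0. Then `u = [e₁,ξ]` works because
`e₁` commutes with `e₂` and `x`. -/
theorem exists_lie_eq_lie_of_lt (S : IsNearPrincipal K e₁ e₂ h₁ h₂)
    (hlt : finrank K (centralizer K {e₁, h₁, h₂}) < finrank K (centralizer K {e₁, h₁, e₂}))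
    {x w : L} (hx : x ∈ centralizer K {e₁, h₁, e₂}) (hw : ⁅h₁, w⁆ = w) :
    ∃ u : L, ⁅h₁, u⁆ = u ∧ ⁅e₂, u⁆ = ⁅x, w⁆ := by
  obtain ⟨hx1, hx2, hx3⟩ := mem_centralizer_triple.1 hx
  obtain ⟨η, hη, rfl⟩ := S.exists_lie_eq_of_lt hlt 0 (y := w) (by simpa using hw)
  rw [Nat.cast_zero, zero_smul] at hη
  obtain ⟨ξ, hξ, hξ'⟩ := S.symm.exists_lie_eq_of_killingForm_eq_zero (y := ⁅x, η⁆)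
    (by rw [lie_lie_comm (lie_eq_zero_symm.1 hx2), hη, lie_zero]) (by
      intro z hz
      have hxa : x ∈ centralizer K {e₂, h₁} := mem_centralizer_pair.2 ⟨hx3, hx2⟩
      rw [killingForm_symm, killingForm_lie_left, S.symm.lie_eq_zero_of_mem_centralizer hxa hz,
        map_zero, neg_zero])
  refine ⟨⁅e₁, ξ⁆, ?_, ?_⟩
  · rw [leibniz_lie, hξ, lie_zero, add_zero, S.lie₁₁]
  · rw [lie_lie_comm (lie_eq_zero_symm.1 S.lie_eq_zero), hξ', lie_lie_comm hx1]

/-- Rank-nullity for `Φ : a ↦ [a,v] mod [e₂,G]` on `A`, of dimension `rk`. Its image is `G/[e₂,G]`,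
of dimension `dim (G ∩ ker e₂) ≥ dim [e₁,𝔱] = rk - dim 𝔷(e₁,h₁,h₂)`, and its kernel contains
`𝔷(e₁,h₁,e₂)`. -/
theorem finrank_triple_le_of_exists (S : IsNearPrincipal K e₁ e₂ h₁ h₂)
    (hlt : finrank K (centralizer K {e₁, h₁, h₂}) < finrank K (centralizer K {e₁, h₁, e₂}))
    {v : L} (hv : ⁅h₁, v⁆ = v)
    (hsurj : ∀ w : L, ⁅h₁, w⁆ = w →
      ∃ a ∈ centralizer K {e₂, h₁}, ∃ u : L, ⁅h₁, u⁆ = u ∧ w = ⁅a, v⁆ + ⁅e₂, u⁆) :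
    finrank K (centralizer K {e₁, h₁, e₂}) ≤ finrank K (centralizer K {e₁, h₁, h₂}) := by
  set G := (LieAlgebra.ad K L h₁).eigenspace 1
  have hG : ∀ {x}, x ∈ G ↔ ⁅h₁, x⁆ = x := by
    intro x; rw [mem_eigenspace_ad, one_smul]
  set U := G.map (LieAlgebra.ad K L e₂)
  set A := (centralizer K {e₂, h₁}).toSubmodule
  set T := (centralizer K {h₁, h₂}).toSubmodule
  have hUG : U ≤ G := by
    rintro _ ⟨u, hu, rfl⟩
    rw [hG, LieAlgebra.ad_apply, lie_lie_comm S.lie₁₂, hG.1 hu]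
  let Φ : L →ₗ[K] L ⧸ U := U.mkQ ∘ₗ (-LieAlgebra.ad K L v)
  have hΦ : ∀ x, Φ x = U.mkQ ⁅x, v⁆ := by
    intro x
    simp only [Φ, LinearMap.comp_apply, LinearMap.neg_apply, LieAlgebra.ad_apply, lie_skew]
  have h1 := finrank_map_add_finrank_inf_ker Φ A
  have h2 := finrank_map_add_finrank_inf_ker U.mkQ G
  have h3 : finrank K U + finrank K (G ⊓ LinearMap.ker (LieAlgebra.ad K L e₂) : Submodule K L) =
    finrank K G := finrank_map_add_finrank_inf_ker (LieAlgebra.ad K L e₂) G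
  have h4 := finrank_map_add_finrank_inf_ker (LieAlgebra.ad K L e₁) T
  rw [Submodule.ker_mkQ, inf_eq_right.2 hUG] at h2
  have h5 : finrank K (G.map U.mkQ) ≤ finrank K (A.map Φ) := by
    refine Submodule.finrank_mono ?_
    rintro _ ⟨w, hw, rfl⟩
    obtain ⟨a, ha, u, hu, rfl⟩ := hsurj w (hG.1 hw)
    refine ⟨a, ha, ?_⟩
    rw [hΦ, map_add, left_eq_add]
    rw [Submodule.mkQ_apply, Submodule.Quotient.mk_eq_zero]
    exact ⟨u, hG.2 hu, rfl⟩
  have h6 : finrank K (centralizer K {e₁, h₁, e₂}) ≤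
      finrank K (A ⊓ LinearMap.ker Φ : Submodule K L) := by
    refine Submodule.finrank_mono (s := (centralizer K {e₁, h₁, e₂}).toSubmodule) ?_
    intro x hx
    obtain ⟨u, hu, hu'⟩ := S.exists_lie_eq_lie_of_lt hlt hx hv
    obtain ⟨hx1, hx2, hx3⟩ := mem_centralizer_triple.1 hx
    refine Submodule.mem_inf.2 ⟨mem_centralizer_pair.2 ⟨hx3, hx2⟩, ?_⟩
    rw [LinearMap.mem_ker, hΦ, ← hu']
    rw [Submodule.mkQ_apply, Submodule.Quotient.mk_eq_zero]
    exact ⟨u, hG.2 hu, rfl⟩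
  -- `[e₁,𝔱]` has degree `(1,0)`, so `lim_{e₂}` embeds its dimension into `G ∩ ker e₂`.
  have h7 : finrank K (T.map (LieAlgebra.ad K L e₁)) ≤
      finrank K (G ⊓ LinearMap.ker (LieAlgebra.ad K L e₂) : Submodule K L) := by
    have hTG : T.map (LieAlgebra.ad K L e₁) ≤ G := by
      rintro _ ⟨y, hy, rfl⟩
      have hy' := mem_centralizer_pair.1 hy
      rw [hG, LieAlgebra.ad_apply, leibniz_lie, lie_eq_zero_symm.1 hy'.1, lie_zero, add_zero,
        S.lie₁₁]
    refine (finrank_le_finrank_limSubmodule (ad_commutator S.lie₂₂) ?_).trans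
      (Submodule.finrank_mono (le_inf (limSubmodule_le_of_forall hTG ?_)
        (limSubmodule_le_ker _ _)))
    · rintro _ ⟨y, hy, rfl⟩
      have hy' := mem_centralizer_pair.1 hy
      rw [LinearMap.mem_ker, LieAlgebra.ad_apply, LieAlgebra.ad_apply, lie_lie_comm S.lie₂₁,
        lie_eq_zero_symm.1 hy'.2, lie_zero]
    · exact fun y hy => hUG ⟨y, hy, rfl⟩
  have h8 : T ⊓ LinearMap.ker (LieAlgebra.ad K L e₁) =
      (centralizer K {e₁, h₁, h₂}).toSubmodule := by
    ext y
    rw [Submodule.mem_inf, LieSubalgebra.mem_toSubmodule, LieSubalgebra.mem_toSubmodule,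
      mem_centralizer_triple, mem_centralizer_pair, LinearMap.mem_ker, LieAlgebra.ad_apply,
      lie_eq_zero_symm (x := e₁)]
    tauto
  rw [h8] at h4
  have h9 : finrank K T = LieAlgebra.rank K L := S.finrank_torus_and_centralizer.1
  have h10 : finrank K A = LieAlgebra.rank K L := S.symm.finrank_torus_and_centralizer.2
  have h11 : finrank K (T.map (LieAlgebra.ad K L e₁)) +
    finrank K (centralizer K {e₁, h₁, h₂}) = finrank K T := h4
  omega

end IsNearPrincipal

open LieAlgebra LieModule

/-! ### Components with respect to the root decomposition. -/

section RootProjection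

variable {K L : Type*} [Field K] [IsAlgClosed K] [CharZero K] [LieRing L] [LieAlgebra K L]
  [Module.Finite K L] [LieAlgebra.IsKilling K L] (H : LieSubalgebra K L) [H.IsCartanSubalgebra]

omit [CharZero K] [LieAlgebra.IsKilling K L] in
theorem iSup_rootSpace_eq_top :
    ⨆ χ : Weight K H L, (rootSpace H χ).toSubmodule = ⊤ := by
  rw [← LieSubmodule.iSup_toSubmodule, iSup_genWeightSpace_eq_top' K H L]
  rfl

omit [IsAlgClosed K] [CharZero K] [Module.Finite K L] [LieAlgebra.IsKilling K L] in
theorem iSupIndep_rootSpace :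
    iSupIndep fun χ : Weight K H L => (rootSpace H χ).toSubmodule :=
  LieSubmodule.iSupIndep_toSubmodule.2 (iSupIndep_genWeightSpace' K H L)

/-- The projection onto a weight space of a Cartan subalgebra. -/
noncomputable def weightProj (χ : Weight K H L) : End K L :=
  gradedProj (iSupIndep_rootSpace H) (iSup_rootSpace_eq_top H) χ

variable {H}

omit [CharZero K] [LieAlgebra.IsKilling K L] in
theorem weightProj_mem (χ : Weight K H L) (x : L) : weightProj H χ x ∈ rootSpace H χ :=
  gradedProj_mem (iSupIndep_rootSpace H) (iSup_rootSpace_eq_top H) χ x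

omit [CharZero K] [LieAlgebra.IsKilling K L] in
theorem weightProj_of_mem {χ : Weight K H L} {x : L} (hx : x ∈ rootSpace H χ) :
    weightProj H χ x = x :=
  gradedProj_of_mem (iSupIndep_rootSpace H) (iSup_rootSpace_eq_top H) hx

omit [CharZero K] [LieAlgebra.IsKilling K L] in
theorem weightProj_of_mem_of_ne {χ : Weight K H L} {ψ : H → K} {x : L} (hx : x ∈ rootSpace H ψ)
    (h : ψ ≠ χ) : weightProj H χ x = 0 := by
  by_cases hx0 : x = 0
  · rw [hx0, map_zero]
  have hψ : genWeightSpace L ψ ≠ ⊥ := fun h0 => hx0 (by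
    have : x ∈ genWeightSpace L ψ := hx
    rw [h0] at this
    simpa using this)
  exact gradedProj_of_mem_ne (iSupIndep_rootSpace H) (iSup_rootSpace_eq_top H)
    (j := (⟨ψ, hψ⟩ : Weight K H L)) hx fun e => h (congrArg (fun w : Weight K H L => (w : H → K)) e)

omit [CharZero K] [LieAlgebra.IsKilling K L] in
theorem exists_weightProj_ne_zero {x : L} (hx : x ≠ 0) :
    ∃ χ : Weight K H L, weightProj H χ x ≠ 0 :=
  exists_gradedProj_ne_zero (iSupIndep_rootSpace H) (iSup_rootSpace_eq_top H) hx

omit [CharZero K] [LieAlgebra.IsKilling K L] in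
theorem sum_weightProj (x : L) : ∑ χ : Weight K H L, weightProj H χ x = x := by
  obtain ⟨s, hs⟩ :=
    exists_finset_sum_gradedProj (iSupIndep_rootSpace H) (iSup_rootSpace_eq_top H) x
  exact hs _ (Finset.subset_univ s)

theorem lie_of_mem_rootSpace {χ : H → K} {x h : L} (hx : x ∈ rootSpace H χ) (hh : h ∈ H) :
    ⁅h, x⁆ = χ ⟨h, hh⟩ • x :=
  IsKilling.lie_eq_smul_of_mem_rootSpace hx ⟨h, hh⟩

theorem weightProj_lie {h : L} (hh : h ∈ H) (χ : Weight K H L) (x : L) :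
    weightProj H χ ⁅h, x⁆ = ⁅h, weightProj H χ x⁆ := by
  refine gradedProj_apply_map (f := LieAlgebra.ad K L h) (σ := id) (iSupIndep_rootSpace H)
    (iSup_rootSpace_eq_top H) Function.injective_id (fun ψ y hy => ?_) χ x
  rw [LieAlgebra.ad_apply, lie_of_mem_rootSpace hy hh]
  exact Submodule.smul_mem _ _ hy

theorem weight_eq_of_weightProj_ne_zero {h x : L} (hh : h ∈ H) {c : K} (hx : ⁅h, x⁆ = c • x)
    {χ : Weight K H L} (hχ : weightProj H χ x ≠ 0) : χ ⟨h, hh⟩ = c := by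
  have h1 := weightProj_lie hh χ x
  rw [hx, map_smul, lie_of_mem_rootSpace (weightProj_mem χ x) hh] at h1
  exact (smul_left_injective K hχ h1).symm

omit [CharZero K] [LieAlgebra.IsKilling K L] in
theorem exists_weight_add_eq {α : Weight K H L} {u y w : L} (hw : w ∈ rootSpace H α) (hw0 : w ≠ 0)
    (huy : ⁅u, y⁆ = w) : ∃ χ ψ : Weight K H L, weightProj H χ u ≠ 0 ∧ weightProj H ψ y ≠ 0 ∧
      (χ : H → K) + ψ = α := by
  by_contra! hne
  have h1 : w = weightProj H α ⁅∑ χ : Weight K H L, weightProj H χ u,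
      ∑ ψ : Weight K H L, weightProj H ψ y⁆ := by
    rw [sum_weightProj, sum_weightProj, huy, weightProj_of_mem hw]
  rw [sum_lie] at h1
  refine hw0 (h1.trans ?_)
  rw [map_sum]
  refine Finset.sum_eq_zero fun χ _ => ?_
  rw [lie_sum, map_sum]
  refine Finset.sum_eq_zero fun ψ _ => ?_
  by_cases h2 : weightProj H χ u = 0
  · rw [h2, zero_lie, map_zero]
  by_cases h3 : weightProj H ψ y = 0
  · rw [h3, lie_zero, map_zero]
  exact weightProj_of_mem_of_ne
    (lie_mem_genWeightSpace_of_mem_genWeightSpace (weightProj_mem χ u) (weightProj_mem ψ y))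
    (hne χ ψ h2 h3)

theorem exists_mem_rootSpace_neg_lie_eq_coroot {α : Weight K H L} (hα : α.IsNonZero) {e : L}
    (he : e ∈ rootSpace H α) (he0 : e ≠ 0) :
    ∃ f ∈ rootSpace H (-α), ⁅e, f⁆ = (IsKilling.coroot α : L) := by
  obtain ⟨h, e', f', ht, he', hf'⟩ := IsKilling.exists_isSl2Triple_of_weight_isNonZero hα
  have hh := IsSl2Triple.h_eq_coroot hα ht he' hf'
  obtain ⟨c, hc⟩ := (finrank_eq_one_iff_of_nonzero' (⟨e, he⟩ : rootSpace H α)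
    (fun h0 => he0 (congrArg Subtype.val h0))).1 (IsKilling.finrank_rootSpace_eq_one α hα) ⟨e', he'⟩
  have hc' : c • e = e' := congrArg Subtype.val hc
  refine ⟨c • f', Submodule.smul_mem _ _ hf', ?_⟩
  rw [lie_smul, ← smul_lie, hc', ht.lie_e_f, hh]

end RootProjection

/-! ### Principal nilpotent elements from a base of the root system. -/

section PrincipalNilpotent

variable {K L : Type*} [Field K] [IsAlgClosed K] [CharZero K] [LieRing L] [LieAlgebra K L]
  [Module.Finite K L] [LieAlgebra.IsKilling K L] {H : LieSubalgebra K L} [H.IsCartanSubalgebra]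

theorem lie_eq_zero_of_simple (b : (IsKilling.rootSystem H).Base) {α β : H.root}
    (hα : α ∈ b.support) (hβ : β ∈ b.support) (hne : α ≠ β) {x y : L}
    (hx : x ∈ rootSpace H α.1) (hy : y ∈ rootSpace H (-β.1)) : ⁅x, y⁆ = 0 := by
  by_contra h0
  have hm := lie_mem_genWeightSpace_of_mem_genWeightSpace hx hy
  have hχ : genWeightSpace L ((α.1 : H → K) + -(β.1 : H → K)) ≠ ⊥ := fun hb => h0 (by
    rw [hb] at hm
    simpa using hm)
  let χ : Weight K H L := ⟨_, hχ⟩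
  have hχ0 : χ.IsNonZero := by
    intro hz
    have hz' : (α.1 : H → K) + -(β.1 : H → K) = 0 := hz
    apply hne
    refine Subtype.ext (Weight.ext fun h => ?_)
    have := congrFun hz' h
    simpa [sub_eq_zero, ← sub_eq_add_neg] using this
  refine b.sub_notMem_range_root hα hβ ⟨⟨χ, by simpa using hχ0⟩, ?_⟩
  ext h
  simp only [IsKilling.rootSystem_root_apply, LinearMap.sub_apply, Weight.toLinear_apply]
  exact (sub_eq_add_neg _ _).symm

/-- The sum of nonzero simple root vectors is a principal nilpotent element. -/
theorem exists_principal (b : (IsKilling.rootSystem H).Base) (e : H.root → L)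
    (he : ∀ α ∈ b.support, e α ∈ rootSpace H α.1) (he0 : ∀ α ∈ b.support, e α ≠ 0) :
    ∃ X : H, (∀ α ∈ b.support, α.1 X = 2) ∧
      ∀ (k : ℕ) (w : L), ⁅(X : L), w⁆ = (2 * ((k : K) + 1)) • w →
        ∃ z : L, ⁅(X : L), z⁆ = (2 * (k : K)) • z ∧ ⁅∑ α ∈ b.support, e α, z⁆ = w := by
  obtain ⟨φ, hφ⟩ := exists_dual_forall_apply_eq_one b.linearIndepOn_root
  set X : H := (evalEquiv K H).symm ((2 : K) • φ) with hXdef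
  have hX : ∀ α ∈ b.support, α.1 X = 2 := by
    intro α hα
    have h1 := hφ α hα
    have h2 : ((IsKilling.rootSystem H).root α) X = ((2 : K) • φ) ((IsKilling.rootSystem H).root α) :=
      apply_evalEquiv_symm_apply _ _ _ _
    rw [LinearMap.smul_apply, h1, IsKilling.rootSystem_root_apply, Weight.toLinear_apply] at h2
    simpa using h2
  refine ⟨X, hX, ?_⟩
  set E := ∑ α ∈ b.support, e α with hE
  have hXspan : X ∈ Submodule.span K ((IsKilling.rootSystem H).coroot '' b.support) := by
    rw [b.span_coroot_support, RootPairing.corootSpan, RootPairing.IsRootSystem.span_coroot_eq_top]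
    trivial
  -- Each simple coroot is `[E,f]` for one negative simple root vector `f`: the other brackets
  -- vanish because a difference of distinct simple roots is not a root. Linearity then produces `F`
  -- completing `X`, `E` to an `sl₂`-triple.
  have hF : ∀ Y ∈ Submodule.span K ((IsKilling.rootSystem H).coroot '' b.support),
      ∃ F : L, ⁅(X : L), F⁆ = -((2 : K) • F) ∧ ⁅E, F⁆ = (Y : L) := by
    intro Y hY
    refine Submodule.span_induction ?_ ⟨0, by simp⟩ ?_ ?_ hY
    · rintro _ ⟨α, hα, rfl⟩
      have hαn : α.1.IsNonZero := (Finset.mem_filter.1 α.2).2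
      obtain ⟨f, hf, hef⟩ := exists_mem_rootSpace_neg_lie_eq_coroot hαn (he α hα) (he0 α hα)
      refine ⟨f, ?_, ?_⟩
      · rw [lie_of_mem_rootSpace hf X.2]
        simp only [Pi.neg_apply, Subtype.coe_eta]
        rw [hX α hα, neg_smul]
      · rw [hE, sum_lie, Finset.sum_eq_single α, hef, IsKilling.rootSystem_coroot_apply]
        · intro β hβ hne
          exact lie_eq_zero_of_simple b hβ hα hne (he β hβ) hf
        · exact fun h => absurd hα h
    · rintro Y Z _ _ ⟨F, hF1, hF2⟩ ⟨G, hG1, hG2⟩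
      refine ⟨F + G, ?_, ?_⟩
      · rw [lie_add, hF1, hG1, smul_add, neg_add]
      · rw [lie_add, hF2, hG2]; rfl
    · rintro c Y _ ⟨F, hF1, hF2⟩
      refine ⟨c • F, ?_, ?_⟩
      · rw [lie_smul, hF1, smul_neg, smul_comm]
      · rw [lie_smul, hF2]; rfl
  obtain ⟨F, hXF, hEF⟩ := hF X hXspan
  have hXE : ⁅(X : L), E⁆ = (2 : K) • E := by
    rw [hE, lie_sum, Finset.smul_sum]
    refine Finset.sum_congr rfl fun α hα => ?_
    rw [lie_of_mem_rootSpace (he α hα) X.2]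
    simp only [Subtype.coe_eta]
    rw [hX α hα]
  intro k w hw
  -- An `sl₂`-triple requires `X ≠ 0`; when `X = 0` the eigenvalue `2 (k + 1) ≠ 0` forces `w = 0`.
  by_cases hX0 : (X : L) = 0
  · have : w = 0 := by
      rw [hX0, zero_lie] at hw
      refine (smul_eq_zero.1 hw.symm).resolve_left ?_
      have : ((2 * (k + 1) : ℕ) : K) ≠ 0 := Nat.cast_ne_zero.2 (by omega)
      simpa using this
    exact ⟨0, by simp, by simp [this]⟩
  have ht : IsSl2Triple (X : L) E F :=
    ⟨hX0, hEF, by rw [hXE, ofNat_smul_eq_nsmul], by rw [hXF, ofNat_smul_eq_nsmul]⟩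
  have hss : (LieAlgebra.ad K L (X : L)).IsSemisimple :=
    IsKilling.isSemisimple_ad_of_mem_isCartanSubalgebra X.2
  have hsurj := le_map_of_injOn_neg (IsKilling.killingForm_nondegenerate K L)
    killingForm_symm (iSup_eigenspace_eq_top hss)
    (fun i j hij x hx y hy => killingForm_eq_zero_of_eigen (mem_eigenspace_ad.1 hx)
      (mem_eigenspace_ad.1 hy) hij)
    (N := LieAlgebra.ad K L E) (fun x y => killingForm_lie_left E x y) (a := (2 : K))
    (fun i x hx => by
      rw [mem_eigenspace_ad] at hx ⊢
      rw [LieAlgebra.ad_apply, lie_smul_eigen hXE hx, add_comm]) (i := 2 * (k : K))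
    -- A nonzero vector killed by `E` is primitive, so its weight is a natural number and cannot be
    -- `-(2k + 2)`.
    (fun x hx hx0 => by
      by_contra hne
      rw [mem_eigenspace_ad] at hx
      obtain ⟨n, hn⟩ := (⟨hne, hx, hx0⟩ : ht.HasPrimitiveVectorWith x _).exists_nat
      have : ((n + 2 * k + 2 : ℕ) : K) = 0 := by push_cast; rw [← hn]; ring
      exact absurd (Nat.cast_eq_zero.1 this) (by omega))
  obtain ⟨z, hz, hzw⟩ := hsurj (mem_eigenspace_ad.2 (by rw [hw]; ring_nf) : w ∈ _)
  exact ⟨z, mem_eigenspace_ad.1 hz, hzw⟩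

/-- On a nonnegative combination of simple roots, `X` takes twice the height. -/
theorem exists_two_mul_of_mem_closure (b : (IsKilling.rootSystem H).Base) {X : H}
    (hX : ∀ α ∈ b.support, α.1 X = 2) {χ : Dual K H}
    (hχ : χ ∈ AddSubmonoid.closure ((IsKilling.rootSystem H).root '' b.support)) (h0 : χ ≠ 0) :
    ∃ k : ℕ, χ X = 2 * ((k : K) + 1) := by
  suffices h : χ = 0 ∨ ∃ k : ℕ, χ X = 2 * ((k : K) + 1) from h.resolve_left h0
  refine AddSubmonoid.closure_induction (motive := fun χ _ => χ = 0 ∨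
    ∃ k : ℕ, χ X = 2 * ((k : K) + 1)) ?_ (Or.inl rfl) ?_ hχ
  · rintro _ ⟨α, hα, rfl⟩
    refine Or.inr ⟨0, ?_⟩
    rw [IsKilling.rootSystem_root_apply, Weight.toLinear_apply, hX α hα]
    simp
  · rintro x y _ _ (rfl | ⟨k, hk⟩) (rfl | ⟨l, hl⟩)
    · simp
    · exact Or.inr ⟨l, by rw [zero_add, hl]⟩
    · exact Or.inr ⟨k, by rw [add_zero, hk]⟩
    · refine Or.inr ⟨k + l + 1, ?_⟩
      rw [LinearMap.add_apply, hk, hl]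
      push_cast
      ring

end PrincipalNilpotent

/-! ### A base adapted to the lexicographic order of degrees. -/

theorem exists_linearMap_rat_one (K : Type*) [Field K] [CharZero K] :
    ∃ φ : K →ₗ[ℚ] ℚ, φ 1 = 1 := by
  obtain ⟨φ, hφ⟩ := exists_dual_forall_apply_eq_one (K := ℚ) (v := fun _ : Unit => (1 : K))
    (s := {()}) ((linearIndepOn_singleton_iff ℚ).2 one_ne_zero)
  exact ⟨φ, hφ () rfl⟩

namespace IsNearPrincipal

variable {K L : Type*} [Field K] [IsAlgClosed K] [CharZero K] [LieRing L] [LieAlgebra K L]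
  [Module.Finite K L] [LieAlgebra.IsKilling K L] {e₁ e₂ h₁ h₂ : L}

omit [IsAlgClosed K] [CharZero K] [LieAlgebra.IsKilling K L] in
theorem mem_torus₁ (S : IsNearPrincipal K e₁ e₂ h₁ h₂) : h₁ ∈ centralizer K {h₁, h₂} :=
  mem_centralizer_pair.2 ⟨lie_self _, S.comm⟩

omit [IsAlgClosed K] [CharZero K] [LieAlgebra.IsKilling K L] in
theorem mem_torus₂ (S : IsNearPrincipal K e₁ e₂ h₁ h₂) : h₂ ∈ centralizer K {h₁, h₂} :=
  mem_centralizer_pair.2 ⟨lie_eq_zero_symm.1 S.comm, lie_self _⟩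

variable [(centralizer K {h₁, h₂}).IsCartanSubalgebra]

theorem exists_intCast_weight₁ (S : IsNearPrincipal K e₁ e₂ h₁ h₂)
    (hlt : finrank K (centralizer K {e₁, h₁, h₂}) < finrank K (centralizer K {e₁, h₁, e₂}))
    (χ : Weight K (centralizer K {h₁, h₂}) L) : ∃ n : ℤ, χ ⟨h₁, S.mem_torus₁⟩ = n := by
  obtain ⟨x, hx, hx0⟩ := χ.exists_ne_zero
  exact S.exists_intCast_of_lt hlt hx0 (lie_of_mem_rootSpace hx S.mem_torus₁)

theorem exists_intCast_weight₂ (S : IsNearPrincipal K e₁ e₂ h₁ h₂)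
    (χ : Weight K (centralizer K {h₁, h₂}) L) (h : χ ⟨h₁, S.mem_torus₁⟩ = 0) :
    ∃ n : ℤ, χ ⟨h₂, S.mem_torus₂⟩ = n := by
  obtain ⟨x, hx, hx0⟩ := χ.exists_ne_zero
  refine S.symm.exists_intCast_of_lie_eq_smul hx0 (lie_of_mem_rootSpace hx S.mem_torus₂) ?_
  rw [lie_of_mem_rootSpace hx S.mem_torus₁, h, zero_smul]

theorem isZero_of_weight_eq_zero (S : IsNearPrincipal K e₁ e₂ h₁ h₂)
    (χ : Weight K (centralizer K {h₁, h₂}) L) (h : χ ⟨h₁, S.mem_torus₁⟩ = 0)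
    (h' : χ ⟨h₂, S.mem_torus₂⟩ = 0) : χ.IsZero := by
  obtain ⟨x, hx, hx0⟩ := χ.exists_ne_zero
  have hxH : x ∈ centralizer K {h₁, h₂} := by
    refine mem_centralizer_pair.2 ⟨?_, ?_⟩
    · rw [lie_eq_zero_symm, lie_of_mem_rootSpace hx S.mem_torus₁, h, zero_smul]
    · rw [lie_eq_zero_symm, lie_of_mem_rootSpace hx S.mem_torus₂, h', zero_smul]
  funext y
  have := S.lie_eq_zero_of_mem_torus y.2 hxH
  rw [lie_of_mem_rootSpace hx y.2] at this
  exact (smul_eq_zero.1 this).resolve_right hx0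

/-- A base of the root system adapted to the lexicographic order on degrees. -/
theorem exists_base_of_lt (S : IsNearPrincipal K e₁ e₂ h₁ h₂)
    (hlt : finrank K (centralizer K {e₁, h₁, h₂}) < finrank K (centralizer K {e₁, h₁, e₂})) :
    ∃ b : (IsKilling.rootSystem (centralizer K {h₁, h₂})).Base,
      (∀ α ∈ b.support, α.1 ⟨h₁, S.mem_torus₁⟩ = 0 ∧ α.1 ⟨h₂, S.mem_torus₂⟩ = 1 ∨
        α.1 ⟨h₁, S.mem_torus₁⟩ = 1) ∧
      (∀ α, α.1 ⟨h₁, S.mem_torus₁⟩ = 0 → α.1 ⟨h₂, S.mem_torus₂⟩ = 1 → α ∈ b.support) ∧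
      (∀ α, α.1 ⟨h₁, S.mem_torus₁⟩ = 1 →
        (IsKilling.rootSystem (centralizer K {h₁, h₂})).root α ∈ AddSubmonoid.closure
          ((IsKilling.rootSystem (centralizer K {h₁, h₂})).root '' b.support)) ∧
      (∀ α, α.1 ⟨h₁, S.mem_torus₁⟩ = -1 →
        -(IsKilling.rootSystem (centralizer K {h₁, h₂})).root α ∈ AddSubmonoid.closure
          ((IsKilling.rootSystem (centralizer K {h₁, h₂})).root '' b.support)) := by
  set H := centralizer K {h₁, h₂}
  set P := IsKilling.rootSystem H
  set x₁ : H := ⟨h₁, S.mem_torus₁⟩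
  set x₂ : H := ⟨h₂, S.mem_torus₂⟩
  -- `K` carries no order and `h₂`-degrees may fail to be integers when the `h₁`-degree is nonzero.
  -- A `ℚ`-linear `φ` fixing the integers makes degrees comparable.
  obtain ⟨φ, hφ⟩ := exists_linearMap_rat_one K
  have hφn : ∀ n : ℤ, φ n = n := by
    intro n
    rw [← zsmul_one, map_zsmul, hφ, zsmul_one]
  obtain ⟨N, hN⟩ : ∃ N : ℕ, ∀ χ : Weight K H L, |φ (χ x₂)| < N := by
    obtain ⟨N, hN⟩ := exists_nat_gt (∑ χ : Weight K H L, |φ (χ x₂)|)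
    exact ⟨N, fun χ => (Finset.single_le_sum (f := fun χ : Weight K H L => |φ (χ x₂)|)
      (fun _ _ => abs_nonneg _) (Finset.mem_univ χ)).trans_lt hN⟩
  -- `N` exceeds every `|φ (χ x₂)|`, so a nonzero integral `h₁`-degree decides the sign of `f`, and
  -- the `h₂`-degree decides only when the `h₁`-degree is 0.
  let f : Dual K H →+ ℚ := AddMonoidHom.mk' (fun χ => φ (χ x₂) + N * φ (χ x₁)) (by
    intro χ ψ
    simp only [LinearMap.add_apply, map_add]
    ring)
  have hf : ∀ α : H.root, f (P.root α) = φ (α.1 x₂) + N * φ (α.1 x₁) := fun α => rfl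
  have hpos : ∀ α : H.root, 0 < f (P.root α) → ∃ m : ℕ, α.1 x₁ = m := by
    intro α hα
    obtain ⟨n, hn⟩ := S.exists_intCast_weight₁ hlt α.1
    have hn' : α.1 x₁ = n := hn
    rw [hf, hn', hφn] at hα
    have h1 := (abs_lt.1 (hN α.1)).2
    have h2 : 0 ≤ n := by
      by_contra hneg
      have h3 : (n : ℚ) ≤ -1 := by exact_mod_cast (by omega : n ≤ -1)
      nlinarith [(Nat.cast_nonneg N : (0 : ℚ) ≤ N)]
    obtain ⟨m, rfl⟩ := Int.eq_ofNat_of_zero_le h2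
    exact ⟨m, by rw [hn']; simp⟩
  have hpos₀ : ∀ α : H.root, α.1 x₁ = 0 → 0 < f (P.root α) → ∃ m : ℕ, α.1 x₂ = m + 1 := by
    intro α h0 hα
    obtain ⟨n, hn⟩ := S.exists_intCast_weight₂ α.1 h0
    have hn' : α.1 x₂ = n := hn
    rw [hf, h0, hn', hφn, map_zero, mul_zero, add_zero] at hα
    have h1 : 0 < n := by exact_mod_cast hα
    obtain ⟨m, rfl⟩ := Int.eq_succ_of_zero_lt h1
    exact ⟨m, by rw [hn']; simp⟩
  have hgt : ∀ (α : H.root) (m : ℕ), α.1 x₁ = m + 1 → 0 < f (P.root α) := by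
    intro α m hm
    have e : (α.1 x₁) = ((m + 1 : ℤ) : K) := by rw [hm]; push_cast; ring
    rw [hf, e, hφn]
    have h1 := (abs_lt.1 (hN α.1)).1
    have h2 : (0 : ℚ) ≤ N * m := by positivity
    push_cast
    nlinarith
  have hgt₀ : ∀ (α : H.root) (m : ℕ), α.1 x₁ = 0 → α.1 x₂ = m + 1 → 0 < f (P.root α) := by
    intro α m h0 hm
    have e : (α.1 x₂) = ((m + 1 : ℤ) : K) := by rw [hm]; push_cast; ring
    rw [hf, h0, e, hφn, map_zero, mul_zero, add_zero]
    push_cast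
    positivity
  have hlt' : ∀ α : H.root, α.1 x₁ = -1 → f (P.root α) < 0 := by
    intro α hm
    have e : (α.1 x₁) = ((-1 : ℤ) : K) := by rw [hm]; push_cast; ring
    rw [hf, e, hφn]
    have h1 := (abs_lt.1 (hN α.1)).2
    push_cast
    linarith
  have hne : ∀ α, f (P.root α) ≠ 0 := by
    intro α
    obtain ⟨n, hn⟩ := S.exists_intCast_weight₁ hlt α.1
    have hn' : α.1 x₁ = n := hn
    by_cases h0 : n = 0
    · have h1 : α.1 x₁ = 0 := by rw [hn', h0, Int.cast_zero]
      obtain ⟨m, hm⟩ := S.exists_intCast_weight₂ α.1 h1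
      have hm' : α.1 x₂ = m := hm
      rw [hf, h1, hm', hφn, map_zero, mul_zero, add_zero]
      intro hm0
      refine (Finset.mem_filter.1 α.2).2 (S.isZero_of_weight_eq_zero α.1 h1 ?_)
      change α.1 x₂ = 0
      rw [hm', Int.cast_eq_zero.1 hm0, Int.cast_zero]
    · rw [hf, hn', hφn]
      obtain ⟨h1, h2⟩ := abs_lt.1 (hN α.1)
      rcases lt_or_gt_of_ne h0 with h | h
      · have h3 : (n : ℚ) ≤ -1 := by exact_mod_cast (by omega : n ≤ -1)
        have : φ (α.1 x₂) + N * n < 0 := by nlinarith [(Nat.cast_nonneg N : (0 : ℚ) ≤ N)]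
        exact this.ne
      · have h3 : (1 : ℚ) ≤ n := by exact_mod_cast (by omega : 1 ≤ n)
        have : 0 < φ (α.1 x₂) + N * n := by nlinarith [(Nat.cast_nonneg N : (0 : ℚ) ≤ N)]
        exact this.ne'
  let _i := P.indexNeg
  have hcl : ∀ α, P.root α ∈
      AddSubmonoid.closure (P.root '' IsAddIndecomposable.baseOf P.root f) ∨
      -P.root α ∈ AddSubmonoid.closure (P.root '' IsAddIndecomposable.baseOf P.root f) :=
    fun α => IsAddIndecomposable.mem_or_neg_mem_closure_baseOf P.root f α (hne α) (by simp)
  let b : P.Base := RootPairing.Base.mk' P (IsAddIndecomposable.baseOf P.root f)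
    (P.linearIndepOn_root_baseOf f hne) hcl
  have hb : ∀ α, α ∈ b.support ↔ α ∈ IsAddIndecomposable.baseOf P.root f := by
    intro α
    exact (Set.toFinite _).mem_toFinset
  have hnonneg : ∀ χ ∈ AddSubmonoid.closure (P.root '' b.support), 0 ≤ f χ := by
    intro χ hχ
    refine AddSubmonoid.closure_induction (motive := fun χ _ => 0 ≤ f χ) ?_ (map_zero f).ge ?_ hχ
    · rintro _ ⟨α, hα, rfl⟩
      exact (((hb α).1 hα).1 : 0 < f (P.root α)).le
    · intro x y _ _ hx hy
      rw [map_add]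
      exact add_nonneg hx hy
  have hindec : ∀ α ∈ b.support, ∀ χ ψ : Weight K H L, ∀ (hχ : χ.IsNonZero) (hψ : ψ.IsNonZero),
      0 < f (P.root ⟨χ, Finset.mem_filter.2 ⟨Finset.mem_univ _, hχ⟩⟩) →
      0 < f (P.root ⟨ψ, Finset.mem_filter.2 ⟨Finset.mem_univ _, hψ⟩⟩) →
      (χ : H → K) + ψ ≠ α.1 := by
    intro α hα χ ψ hχ hψ h1 h2 hadd
    have h3 : P.root α = P.root ⟨χ, Finset.mem_filter.2 ⟨Finset.mem_univ _, hχ⟩⟩ +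
        P.root ⟨ψ, Finset.mem_filter.2 ⟨Finset.mem_univ _, hψ⟩⟩ := by
      ext y
      exact (congrFun hadd y).symm
    rcases ((hb α).1 hα).2 _ h1 _ h2 h3 with h | h
    · rw [h, map_zero] at h1
      exact lt_irrefl _ h1
    · rw [h, map_zero] at h2
      exact lt_irrefl _ h2
  refine ⟨b, ?_, ?_, ?_, ?_⟩
  · intro α hα
    have hα0 : 0 < f (P.root α) := ((hb α).1 hα).1
    obtain ⟨w, hw, hw0⟩ := α.1.exists_ne_zero
    obtain ⟨m, hm⟩ := hpos α hα0
    match m, hm with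
    | 0, hm =>
      have hm0 : α.1 x₁ = 0 := by rw [hm, Nat.cast_zero]
      refine Or.inl ⟨hm0, ?_⟩
      obtain ⟨n, hn⟩ := hpos₀ α hm0 hα0
      match n, hn with
      | 0, hn => rw [hn]; simp
      | n + 1, hn =>
        exfalso
        -- A root vector of degree `(0, n + 2)` is a bracket `[e₂,y]`, so its root splits as a sum
        -- of two positive roots and is not simple.
        obtain ⟨y, hy2, hy1, hye⟩ := S.symm.exists_lie_eq_of_levi (n + 1) (y := w)
          (by rw [lie_of_mem_rootSpace hw S.mem_torus₂]; exact congrArg (· • w) hn)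
          (by rw [lie_of_mem_rootSpace hw S.mem_torus₁]; exact (congrArg (· • w) hm0).trans
                (zero_smul K w))
        obtain ⟨χ, ψ, hχ, hψ, hadd⟩ := exists_weight_add_eq hw hw0 hye
        have hχ1 := weight_eq_of_weightProj_ne_zero S.mem_torus₁ (c := (0 : K))
          (by rw [S.lie₁₂, zero_smul]) hχ
        have hχ2 := weight_eq_of_weightProj_ne_zero S.mem_torus₂ (c := (1 : K))
          (by rw [S.lie₂₂, one_smul]) hχ
        have hψ1 := weight_eq_of_weightProj_ne_zero S.mem_torus₁ (c := (0 : K))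
          (by rw [hy1, zero_smul]) hψ
        have hψ2 := weight_eq_of_weightProj_ne_zero S.mem_torus₂ hy2 hψ
        refine hindec α hα χ ψ (fun h => ?_) (fun h => ?_) (hgt₀ _ 0 hχ1 ?_)
          (hgt₀ _ n hψ1 ?_) hadd
        · rw [show χ ⟨h₂, S.mem_torus₂⟩ = 0 from congrFun h _] at hχ2
          exact zero_ne_one hχ2
        · rw [show ψ ⟨h₂, S.mem_torus₂⟩ = 0 from congrFun h _] at hψ2
          exact absurd hψ2.symm (Nat.cast_ne_zero.2 n.succ_ne_zero)
        · rw [Nat.cast_zero, zero_add]; exact hχ2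
        · exact hψ2.trans (by push_cast; ring)
    | 1, hm => exact Or.inr (by rw [hm, Nat.cast_one])
    | m + 2, hm =>
      exfalso
      -- Likewise a root of `h₁`-degree `m + 2` splits through `e₁` into positive roots of degrees
      -- `1` and `m + 1`.
      obtain ⟨y, hy1, hye⟩ := S.exists_lie_eq_of_lt hlt (m + 1) (y := w)
          (by
            rw [lie_of_mem_rootSpace hw S.mem_torus₁]
            exact congrArg (· • w) (hm.trans (by push_cast; ring)))
      obtain ⟨χ, ψ, hχ, hψ, hadd⟩ := exists_weight_add_eq hw hw0 hye
      have hχ1 := weight_eq_of_weightProj_ne_zero S.mem_torus₁ (c := (1 : K))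
        (by rw [S.lie₁₁, one_smul]) hχ
      have hψ1 := weight_eq_of_weightProj_ne_zero S.mem_torus₁ hy1 hψ
      refine hindec α hα χ ψ (fun h => ?_) (fun h => ?_) (hgt _ 0 ?_) (hgt _ m ?_) hadd
      · rw [show χ ⟨h₁, S.mem_torus₁⟩ = 0 from congrFun h _] at hχ1
        exact zero_ne_one hχ1
      · rw [show ψ ⟨h₁, S.mem_torus₁⟩ = 0 from congrFun h _] at hψ1
        exact absurd hψ1.symm (Nat.cast_ne_zero.2 m.succ_ne_zero)
      · rw [Nat.cast_zero, zero_add]; exact hχ1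
      · exact hψ1.trans (by push_cast; ring)
  · intro α hα1 hα2
    rw [hb]
    -- In a splitting of a root of degree `(0,1)` both summands would have `h₁`-degree 0, hence
    -- `h₂`-degree at least 1 each, which is too much.
    refine ⟨hgt₀ α 0 hα1 (by rw [hα2]; simp), fun β hβ γ hγ hadd => ?_⟩
    exfalso
    have hs : ∀ y, α.1 y = β.1 y + γ.1 y := fun y => congr($hadd y)
    obtain ⟨m, hm⟩ := hpos β hβ
    obtain ⟨n, hn⟩ := hpos γ hγ
    have h1 : ((m + n : ℕ) : K) = 0 := by
      push_cast
      rw [← hm, ← hn, ← hs]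
      exact hα1
    have h2 := Nat.cast_eq_zero.1 h1
    obtain ⟨rfl, rfl⟩ : m = 0 ∧ n = 0 := by omega
    obtain ⟨m, hm⟩ := hpos₀ β (by rw [hm, Nat.cast_zero]) hβ
    obtain ⟨n, hn⟩ := hpos₀ γ (by rw [hn, Nat.cast_zero]) hγ
    have h3 : ((m + n + 1 : ℕ) : K) = 0 := by
      have := hs x₂
      rw [hm, hn, show α.1 x₂ = 1 from hα2] at this
      push_cast
      linear_combination -this
    exact absurd (Nat.cast_eq_zero.1 h3) (by omega)
  · intro α hα
    refine (b.root_mem_or_neg_mem α).resolve_right fun h => ?_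
    have h1 := hnonneg _ h
    rw [map_neg] at h1
    have h2 := hgt α 0 (by rw [Nat.cast_zero, zero_add]; exact hα)
    linarith
  · intro α hα
    refine (b.root_mem_or_neg_mem α).resolve_left fun h => ?_
    exact absurd (hnonneg _ h) (not_le.2 (hlt' α hα))

end IsNearPrincipal

/-! ### Completing `e₂` to a principal nilpotent, and the equality of triple centralizers. -/

namespace IsNearPrincipal

variable {K L : Type*} [Field K] [IsAlgClosed K] [CharZero K] [LieRing L] [LieAlgebra K L]
  [Module.Finite K L] [LieAlgebra.IsKilling K L] {e₁ e₂ h₁ h₂ : L}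

/-- A root vector of weight `α` is `[e₂,y]` with `y ∈ 𝔱`, hence a multiple of the `α`-component of
`e₂`. -/
theorem weightProj_ne_zero_of_levi [(centralizer K {h₁, h₂}).IsCartanSubalgebra]
    (S : IsNearPrincipal K e₁ e₂ h₁ h₂) (α : Weight K (centralizer K {h₁, h₂}) L)
    (h1 : α ⟨h₁, S.mem_torus₁⟩ = 0) (h2 : α ⟨h₂, S.mem_torus₂⟩ = 1) :
    weightProj (centralizer K {h₁, h₂}) α e₂ ≠ 0 := by
  intro h0
  obtain ⟨w, hw, hw0⟩ := α.exists_ne_zero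
  have hw1 : ⁅h₁, w⁆ = 0 := by rw [lie_of_mem_rootSpace hw S.mem_torus₁, h1, zero_smul]
  have hw2 : ⁅h₂, w⁆ = w := by rw [lie_of_mem_rootSpace hw S.mem_torus₂, h2, one_smul]
  obtain ⟨y, hy2, hy1, hye⟩ := S.symm.exists_lie_eq_of_levi 0 (y := w) (by simpa using hw2) hw1
  rw [Nat.cast_zero, zero_smul] at hy2
  have hyH : y ∈ centralizer K {h₁, h₂} :=
    mem_centralizer_pair.2 ⟨lie_eq_zero_symm.1 hy1, lie_eq_zero_symm.1 hy2⟩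
  refine hw0 ?_
  rw [← weightProj_of_mem hw, ← hye, ← lie_skew, map_neg, weightProj_lie hyH, h0, lie_zero,
    neg_zero]

/-- A degree one element `v` such that `e₂ + v` is a principal nilpotent element. -/
theorem exists_complement_of_lt (S : IsNearPrincipal K e₁ e₂ h₁ h₂)
    (hlt : finrank K (centralizer K {e₁, h₁, h₂}) < finrank K (centralizer K {e₁, h₁, e₂})) :
    ∃ v : L, ⁅h₁, v⁆ = v ∧ ∀ w : L, ⁅h₁, w⁆ = w →
      ∃ a ∈ centralizer K {e₂, h₁}, ∃ u : L, ⁅h₁, u⁆ = u ∧ w = ⁅a, v⁆ + ⁅e₂, u⁆ := by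
  classical
  have := S.isCartanSubalgebra_torus
  set H := centralizer K {h₁, h₂}
  obtain ⟨b, hb, hb₀, hb₁, hbneg⟩ := S.exists_base_of_lt hlt
  have hex : ∀ α : H.root, ∃ x ∈ rootSpace H α.1, x ≠ 0 := fun α => α.1.exists_ne_zero
  choose g hg hg0 using hex
  let e : H.root → L := fun α =>
    if α.1 ⟨h₁, S.mem_torus₁⟩ = 0 then weightProj H α.1 e₂ else g α
  have he : ∀ α ∈ b.support, e α ∈ rootSpace H α.1 := by
    intro α _
    by_cases h : α.1 ⟨h₁, S.mem_torus₁⟩ = 0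
    · simp only [e, if_pos h]; exact weightProj_mem _ _
    · simp only [e, if_neg h]; exact hg α
  have he0 : ∀ α ∈ b.support, e α ≠ 0 := by
    intro α hα
    by_cases h : α.1 ⟨h₁, S.mem_torus₁⟩ = 0
    · simp only [e, if_pos h]
      refine S.weightProj_ne_zero_of_levi α.1 h ?_
      rcases hb α hα with h' | h'
      · exact h'.2
      · exact absurd (h.symm.trans h') zero_ne_one
    · simp only [e, if_neg h]; exact hg0 α
  obtain ⟨X, hX, hsurj⟩ := exists_principal b e he he0
  set v := ∑ α ∈ b.support with α.1 ⟨h₁, S.mem_torus₁⟩ ≠ 0, e α with hv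
  have hv1 : ⁅h₁, v⁆ = v := by
    rw [hv, lie_sum]
    refine Finset.sum_congr rfl fun α hα => ?_
    rw [Finset.mem_filter] at hα
    rw [lie_of_mem_rootSpace (he α hα.1) S.mem_torus₁,
      (hb α hα.1).resolve_left fun h => hα.2 h.1, one_smul]
  -- Every weight occurring in `e₂` has degree `(0,1)`, and all roots of that degree are simple.
  have he2 : ∑ α ∈ b.support with α.1 ⟨h₁, S.mem_torus₁⟩ = 0, e α = e₂ := by
    refine Eq.trans ?_ (sum_weightProj (H := H) e₂)
    have h1 : ∀ α ∈ b.support.filter fun α => α.1 ⟨h₁, S.mem_torus₁⟩ = 0,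
        e α = weightProj H α.1 e₂ := by
      intro α hα
      simp only [e, if_pos (Finset.mem_filter.1 hα).2]
    rw [Finset.sum_congr rfl h1]
    refine Finset.sum_of_injOn (fun α : H.root => α.1) (fun α _ β _ h => Subtype.ext h)
      (fun _ _ => Finset.mem_coe.2 (Finset.mem_univ _)) ?_ (fun _ _ => rfl)
    intro χ _ hχ
    by_contra h0
    have hχ1 := weight_eq_of_weightProj_ne_zero S.mem_torus₁ (c := (0 : K))
      (by rw [S.lie₁₂, zero_smul]) h0
    have hχ2 := weight_eq_of_weightProj_ne_zero S.mem_torus₂ (c := (1 : K))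
      (by rw [S.lie₂₂, one_smul]) h0
    have hχn : χ.IsNonZero := by
      intro h
      rw [show χ ⟨h₂, S.mem_torus₂⟩ = 0 from congrFun h _] at hχ2
      exact zero_ne_one hχ2
    exact hχ ⟨⟨χ, Finset.mem_filter.2 ⟨Finset.mem_univ _, hχn⟩⟩,
      Finset.mem_coe.2 (Finset.mem_filter.2 ⟨hb₀ _ hχ1 hχ2, hχ1⟩), rfl⟩
  have hE : ∑ α ∈ b.support, e α = e₂ + v := by
    rw [← Finset.sum_filter_add_sum_filter_not b.support
      (fun α => α.1 ⟨h₁, S.mem_torus₁⟩ = 0) e, he2]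
  rw [hE] at hsurj
  refine ⟨v, hv1, ?_⟩
  have hroot : ∀ (χ : Weight K H L) (w : L), w ∈ rootSpace H χ → χ ⟨h₁, S.mem_torus₁⟩ = 1 →
      ∃ a ∈ centralizer K {e₂, h₁}, ∃ u : L, ⁅h₁, u⁆ = u ∧ w = ⁅a, v⁆ + ⁅e₂, u⁆ := by
    intro χ w hw hχ1
    have hχn : χ.IsNonZero := by
      intro h
      rw [show χ ⟨h₁, S.mem_torus₁⟩ = 0 from congrFun h _] at hχ1
      exact zero_ne_one hχ1
    let α : H.root := ⟨χ, Finset.mem_filter.2 ⟨Finset.mem_univ _, hχn⟩⟩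
    obtain ⟨k, hk⟩ := exists_two_mul_of_mem_closure b hX (hb₁ α hχ1) (RootPairing.ne_zero _ _)
    have hk' : χ X = 2 * ((k : K) + 1) := hk
    obtain ⟨z, hz, hzw⟩ := hsurj k w (by rw [lie_of_mem_rootSpace hw X.2, ← hk'])
    have hπe := fun μ => eigenProj_comm S.semisimple₁
      (commute_ad (K := K) (lie_eq_zero_symm.1 S.lie₁₂)) μ z
    have hπv := fun μ => eigenProj_shift S.semisimple₁ (ad_commutator hv1) μ z
    have hw1 : w ∈ (LieAlgebra.ad K L h₁).eigenspace 1 := by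
      rw [mem_eigenspace_ad, lie_of_mem_rootSpace hw S.mem_torus₁, hχ1]
    -- Roots of `h₁`-degree `-1` are negative, so `X` takes values at most `-2` on them, whereas `X`
    -- acts on `z` by `2k ≥ 0`.
    have hneg : eigenProj S.semisimple₁ (-1) z = 0 := by
      by_contra hne
      obtain ⟨ψ, hψ⟩ := exists_weightProj_ne_zero (H := H) hne
      have hψ1 := weight_eq_of_weightProj_ne_zero S.mem_torus₁ (apply_eigenProj S.semisimple₁ _ z) hψ
      have hXz : ⁅(X : L), eigenProj S.semisimple₁ (-1) z⁆ =
          (2 * (k : K)) • eigenProj S.semisimple₁ (-1) z := by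
        have hXh : ⁅(X : L), h₁⁆ = 0 := (mem_centralizer_pair.1 X.2).1
        have := eigenProj_comm S.semisimple₁ (commute_ad (K := K) hXh) (-1) z
        rw [LieAlgebra.ad_apply, LieAlgebra.ad_apply, hz, map_smul] at this
        exact this.symm
      have hψX := weight_eq_of_weightProj_ne_zero X.2 hXz hψ
      have hψn : ψ.IsNonZero := by
        intro h
        rw [show ψ ⟨h₁, S.mem_torus₁⟩ = 0 from congrFun h _] at hψ1
        exact one_ne_zero (neg_eq_zero.1 hψ1.symm)
      let β : H.root := ⟨ψ, Finset.mem_filter.2 ⟨Finset.mem_univ _, hψn⟩⟩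
      obtain ⟨l, hl⟩ := exists_two_mul_of_mem_closure b hX (hbneg β hψ1)
        (neg_ne_zero.2 (RootPairing.ne_zero _ _))
      have hl' : -(ψ X) = 2 * ((l : K) + 1) := hl
      have hψX' : ψ X = 2 * (k : K) := hψX
      have h3 : ((2 * (k + l + 1) : ℕ) : K) = 0 := by
        push_cast
        linear_combination -hl' - hψX'
      exact absurd (Nat.cast_eq_zero.1 h3) (by omega)
    -- Compare components of `[e₂ + v, z] = w`: degree 0 gives `[e₂,z₀] = 0` as `z₋₁ = 0`, and
    -- degree 1 gives `[e₂,z₁] + [v,z₀] = w`. The sign turns `[v,z₀]` into `[a,v]`.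
    refine ⟨-eigenProj S.semisimple₁ 0 z, neg_mem (mem_centralizer_pair.2 ⟨?_, ?_⟩),
      eigenProj S.semisimple₁ 1 z, ?_, ?_⟩
    · rw [lie_eq_zero_symm]
      have h1 : eigenProj S.semisimple₁ 0 w = 0 :=
        eigenProj_of_mem_ne S.semisimple₁ hw1 one_ne_zero
      have h2 := hπv (-1)
      rw [neg_add_cancel, hneg, map_zero, LieAlgebra.ad_apply] at h2
      have h3 := hπe 0
      rw [LieAlgebra.ad_apply, LieAlgebra.ad_apply] at h3
      rw [← hzw, add_lie, map_add, h2, add_zero, h3] at h1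
      exact h1
    · rw [lie_eq_zero_symm]
      have := apply_eigenProj S.semisimple₁ 0 z
      rwa [zero_smul] at this
    · have := apply_eigenProj S.semisimple₁ 1 z
      rwa [one_smul] at this
    · have h1 : eigenProj S.semisimple₁ 1 w = w := eigenProj_of_mem S.semisimple₁ hw1
      have h2 := hπv 0
      rw [zero_add, LieAlgebra.ad_apply, LieAlgebra.ad_apply] at h2
      have h3 := hπe 1
      rw [LieAlgebra.ad_apply, LieAlgebra.ad_apply] at h3
      have h4 : eigenProj S.semisimple₁ 1 ⁅e₂ + v, z⁆ = w := by rw [hzw]; exact h1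
      rw [add_lie, map_add, h2, h3] at h4
      rw [neg_lie, lie_skew, add_comm, h4]
  intro w hw
  have hsum : ∀ s : Finset (Weight K H L), ∃ a ∈ centralizer K {e₂, h₁}, ∃ u : L,
      ⁅h₁, u⁆ = u ∧ ∑ χ ∈ s, weightProj H χ w = ⁅a, v⁆ + ⁅e₂, u⁆ := by
    intro s
    induction s using Finset.induction_on with
    | empty => exact ⟨0, zero_mem _, 0, by simp, by simp⟩
    | insert χ s hχ ih =>
      obtain ⟨a, ha, u, hu, hau⟩ := ih
      rw [Finset.sum_insert hχ, hau]
      by_cases h0 : weightProj H χ w = 0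
      · exact ⟨a, ha, u, hu, by rw [h0, zero_add]⟩
      · obtain ⟨a', ha', u', hu', hau'⟩ := hroot χ _ (weightProj_mem χ w)
          (weight_eq_of_weightProj_ne_zero S.mem_torus₁ (c := (1 : K)) (by rw [hw, one_smul]) h0)
        refine ⟨a' + a, add_mem ha' ha, u' + u, by rw [lie_add, hu, hu'], ?_⟩
        rw [hau', add_lie, lie_add]
        abel
  obtain ⟨a, ha, u, hu, hau⟩ := hsum Finset.univ
  rw [sum_weightProj] at hau
  exact ⟨a, ha, u, hu, hau⟩

theorem finrank_triple_eq (S : IsNearPrincipal K e₁ e₂ h₁ h₂) :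
    finrank K (centralizer K {e₁, h₁, e₂}) = finrank K (centralizer K {e₁, h₁, h₂}) := by
  refine le_antisymm ?_ S.finrank_triple_le
  by_contra! hlt
  obtain ⟨v, hv, hsurj⟩ := S.exists_complement_of_lt hlt
  exact absurd (S.finrank_triple_le_of_exists hlt hv hsurj) (not_le.2 hlt)

end IsNearPrincipal

end NilpotentPair

theorem theorem2p3 {K : Type*} {L : Type*} [Field K] [IsAlgClosed K] [CharZero K]
    [LieRing L] [LieAlgebra K L] [Module.Finite K L] [LieAlgebra.IsSemisimple K L]
    (e₁ e₂ h₁ h₂ : L)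
    (he : NilpotentPair.IsPrincipalNilpotentPair K e₁ e₂ ∨
      NilpotentPair.IsAlmostPrincipalNilpotentPair K e₁ e₂)
    (hh : NilpotentPair.IsAssociatedSemisimplePair K e₁ e₂ h₁ h₂) :
    (NilpotentPair.IsRegularNilpotentIn K (NilpotentPair.centralizer K {h₂}) e₁ ∧
      NilpotentPair.IsRegularNilpotentIn K (NilpotentPair.centralizer K {h₁}) e₂) ∧
    (NilpotentPair.lim K e₁ (NilpotentPair.centralizer K {h₁, h₂}).toSubmodule =
        (NilpotentPair.centralizer K {e₁, h₂}).toSubmodule ∧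
      NilpotentPair.lim K e₂ (NilpotentPair.centralizer K {h₁, h₂}).toSubmodule =
        (NilpotentPair.centralizer K {e₂, h₁}).toSubmodule) ∧
    (Module.finrank K (NilpotentPair.centralizer K {e₁, h₁, e₂}) =
        Module.finrank K (NilpotentPair.centralizer K {e₁, h₁, h₂}) ∧
      Module.finrank K (NilpotentPair.centralizer K {e₂, h₂, e₁}) =
        Module.finrank K (NilpotentPair.centralizer K {e₂, h₂, h₁})) ∧
    ((NilpotentPair.centralizer K {e₁, h₁, h₂}).toSubmodule =
        NilpotentPair.centre K (NilpotentPair.centralizer K {h₂}) ∧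
      (NilpotentPair.centralizer K {e₂, h₁, h₂}).toSubmodule =
        NilpotentPair.centre K (NilpotentPair.centralizer K {h₁})) := by
  have S : NilpotentPair.IsNearPrincipal K e₁ e₂ h₁ h₂ :=
    { hh with
      lie_eq_zero := he.elim (fun h => h.comm) (fun h => h.comm)
      finrank_le := he.elim (fun h => by rw [h.finrank_centralizer]; omega)
        (fun h => h.finrank_centralizer.le) }
  refine ⟨⟨S.isRegularNilpotentIn, S.symm.isRegularNilpotentIn⟩, ⟨S.lim_eq, ?_⟩,
    ⟨S.finrank_triple_eq, S.symm.finrank_triple_eq⟩, S.centralizer_eq_centre, ?_⟩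
  · rw [Set.pair_comm h₁ h₂]
    exact S.symm.lim_eq
  · rw [Set.pair_comm h₁ h₂]
    exact S.symm.centralizer_eq_centre
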